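/- Let $\lambda_x>0$ ($x\in\mathbb N=\{0,1,2,\dots\}$), $\nu_0=0$ and $\nu_x>0$ ($x\ge1$) be birth and death rates whose (minimal) birth-death process $(X_t)_{t\ge0}$ is non-explosive; write $P_t^x(y)=\mathbb P_x(X_t=y)$ and $P_tf(x)=\mathbb E_x[f(X_t)]=\sum_y f(y)P_t^x(y)$. Let $\rho:\mathbb N\to(0,\infty)$ be strictly increasing, $u_x=\rho(x+1)-\rho(x)$ and $d_u(x,y)=|\rho(x)-\rho(y)|$. Let $(X_{u,t})_{t\ge0}$ be the minimal birth-death process with birth rates $\lambda^u_x=\frac{u_{x+1}}{u_x}\lambda_{x+1}$ and death rates $\nu^u_x=\frac{u_{x-1}}{u_x}\nu_x$ (with $\nu^u_0=0$), with semigroup $(P_{u,t})_{t\ge0}$, and let $$V_u(x)=\nu_{x+1}-\nu^u_x+\lambda_x-\lambda^u_x .$$ For a distance $d$ on $\mathbb N$ put $\|g\|_{\mathrm{Lip}(d)}=\sup_{x\ne y}\frac{|g(x)-g(y)|}{d(x,y)}\in[0,\infty]$ and $\|P_t\|_{\mathrm{Lip}(d)\to\mathrm{Lip}(d)}=\sup\{\|P_tf\|_{\mathrm{Lip}(d)}:\|f\|_{\mathrm{Lip}(d)}\le1\}$.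 Assume that for all $t\ge0$ and $x\in\mathbb N$ the functions $\lambda^u,\nu^u,V_u$ are integrable with respect to the law of $X_{u,t}$ started at $x$, that $\sum_y d_u(y,x_0)P_t^x(y)<\infty$ for some $x_0\in\mathbb N$, and that $V_u$ is bounded below. Then for every $t\ge0$, $$\|P_t\|_{\mathrm{Lip}(d_u)\to\mathrm{Lip}(d_u)}=\|P_t\rho\|_{\mathrm{Lip}(d_u)}=\sup_{x\in\mathbb N}\mathbb E_x\Big[\exp\Big(-\int_0^tV_u(X_{u,s})\,ds\Big)\Big].$$ Moreover the Wasserstein curvature of $(X_t)_{t\ge0}$ with respect to $d_u$, that is, the largest constant $\sigma\in\mathbb R$ such that $\|P_t\|_{\mathrm{Lip}(d_u)\to\mathrm{Lip}(d_u)}\le e^{-\sigma t}$ for all $t\ge0$, exists and equals $\inf_{y\in\mathbb N}V_u(y)$. -/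

import Mathlib

open MeasureTheory ProbabilityTheory Set Filter Topology
open scoped ENNReal

namespace BirthDeath

noncomputable section

/-! ### The minimal birth-death process

The process is built from its embedded jump chain and its holding times. The underlying randomness
is an i.i.d. sequence of pairs: a unit exponential variable, rescaled to give a holding time, and
an independent uniform variable, which decides between a birth and a death. -/

/-- The sample space: one (clock, decision) pair for each jump. -/
abbrev Noise : Type := ℕ → ℝ × unitInterval

/-- The law of the driving noise: i.i.d. pairs of independent unit exponential and uniform
variables. -/
def noiseLaw : Measure Noise :=
  Measure.infinitePi (fun _ : ℕ => (expMeasure 1).prod (volume : Measure unitInterval))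

/-- The embedded chain started at `x`: from `y` it goes to `y + 1` with probability
`birth y / (birth y + death y)` and to `y - 1` otherwise. -/
def embeddedChain (birth death : ℕ → ℝ) (x : ℕ) (ω : Noise) : ℕ → ℕ
  | 0 => x
  | n + 1 =>
    if ((ω n).2 : ℝ) ≤ birth (embeddedChain birth death x ω n) /
        (birth (embeddedChain birth death x ω n) + death (embeddedChain birth death x ω n))
    then embeddedChain birth death x ω n + 1
    else embeddedChain birth death x ω n - 1

/-- The time spent at the `n`-th visited state `y`, exponential with parameter
`birth y + death y` given the embedded chain. -/
def holdingTime (birth death : ℕ → ℝ) (x : ℕ) (ω : Noise) (n : ℕ) : ℝ :=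
  (ω n).1 / (birth (embeddedChain birth death x ω n) + death (embeddedChain birth death x ω n))

/-- The time of the `n`-th jump (`0` for `n = 0`). -/
def jumpTime (birth death : ℕ → ℝ) (x : ℕ) (ω : Noise) (n : ℕ) : ℝ :=
  ∑ k ∈ Finset.range n, holdingTime birth death x ω k

open Classical in
/-- The minimal birth-death process started at `x`, at time `t ≥ 0`: the `n`-th visited state for
the `n` with `jumpTime n ≤ t < jumpTime (n + 1)`, and the cemetery `none` if there have been
infinitely many jumps by time `t` (explosion). -/
def process (birth death : ℕ → ℝ) (x : ℕ) (t : ℝ) (ω : Noise) : Option ℕ :=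
  if h : ∃ n, t < jumpTime birth death x ω (n + 1) then
    some (embeddedChain birth death x ω (Nat.find h))
  else none

/-- Almost surely there are finitely many jumps in finite time, from every starting point. -/
def NonExplosive (birth death : ℕ → ℝ) : Prop :=
  ∀ x, ∀ᵐ ω ∂noiseLaw, Tendsto (jumpTime birth death x ω) atTop atTop

/-- The transition probability `P_t^x(y) = ℙ_x(X_t = y)`. -/
def transProb (birth death : ℕ → ℝ) (t : ℝ) (x y : ℕ) : ℝ :=
  noiseLaw.real {ω | process birth death x t ω = some y}

/-- The semigroup `P_t f(x) = ∑ y, f(y) P_t^x(y)`. -/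
def semigroup (birth death : ℕ → ℝ) (t : ℝ) (f : ℕ → ℝ) (x : ℕ) : ℝ :=
  ∑' y, f y * transProb birth death t x y

/-- `f` is integrable with respect to all transition probabilities `P_t^x`, `t ≥ 0`. -/
def SemigroupIntegrable (birth death : ℕ → ℝ) (f : ℕ → ℝ) : Prop :=
  ∀ t, 0 ≤ t → ∀ x, Summable fun y => f y * transProb birth death t x y

/-- The Feynman-Kac expectation `𝔼_x[exp(-∫₀ᵗ V(X_s) ds)]`, over the paths which are alive at
time `t`. -/
def feynmanKac (birth death : ℕ → ℝ) (V : ℕ → ℝ) (t : ℝ) (x : ℕ) : ℝ≥0∞ :=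
  ∫⁻ ω, (process birth death x t ω).elim 0
    (fun _ => ENNReal.ofReal
      (Real.exp (-∫ s in (0 : ℝ)..t, (process birth death x s ω).elim 0 V))) ∂noiseLaw

/-! ### The modified process and its potential -/

/-- The modified birth rate `(u_{x+1} / u_x) λ_{x+1}`. -/
def modBirth (birth u : ℕ → ℝ) (x : ℕ) : ℝ := u (x + 1) / u x * birth (x + 1)

/-- The modified death rate `(u_{x-1} / u_x) ν_x`; it is `0` at `x = 0` because `ν_0 = 0`. -/
def modDeath (death u : ℕ → ℝ) (x : ℕ) : ℝ := u (x - 1) / u x * death x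

/-- The potential `V_u(x) = ν_{x+1} - ν^u_x + λ_x - λ^u_x`. -/
def potential (birth death u : ℕ → ℝ) (x : ℕ) : ℝ :=
  death (x + 1) - modDeath death u x + birth x - modBirth birth u x

/-! ### Lipschitz norms and Wasserstein curvature -/

/-- The increments `u_x = ρ(x+1) - ρ(x)`. -/
def weight (ρ : ℕ → ℝ) (x : ℕ) : ℝ := ρ (x + 1) - ρ x

/-- The distance `d_u(x, y) = |ρ(x) - ρ(y)|`. -/
def weightDist (ρ : ℕ → ℝ) (x y : ℕ) : ℝ := |ρ x - ρ y|

/-- The Lipschitz seminorm with respect to `d`, equal to `∞` if `g` is not Lipschitz. -/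
def lipNorm (d : ℕ → ℕ → ℝ) (g : ℕ → ℝ) : ℝ≥0∞ :=
  ⨆ (x : ℕ) (y : ℕ) (_ : x ≠ y), ENNReal.ofReal (|g x - g y| / d x y)

/-- `‖P‖_{Lip(d) → Lip(d)}`: the supremum of `‖P f‖_{Lip(d)}` over the `1`-Lipschitz `f`. -/
def lipOpNorm (d : ℕ → ℕ → ℝ) (P : (ℕ → ℝ) → ℕ → ℝ) : ℝ≥0∞ :=
  ⨆ (f : ℕ → ℝ) (_ : lipNorm d f ≤ 1), lipNorm d (P f)

/-- The probability measure `ξ` on `ℕ` has a finite first moment for `d`. -/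
def FiniteMoment (d : ℕ → ℕ → ℝ) (ξ : ℕ → ℝ) : Prop :=
  ∃ x₀, Summable fun y => d y x₀ * ξ y

/-- `σ` is the Wasserstein curvature for `d`: the largest constant with
`‖P_t‖_{Lip(d) → Lip(d)} ≤ e^{-σ t}` for all `t ≥ 0`. -/
def IsWassersteinCurvature (birth death : ℕ → ℝ) (d : ℕ → ℕ → ℝ) (σ : ℝ) : Prop :=
  IsGreatest {κ : ℝ | ∀ t, 0 ≤ t →
    lipOpNorm d (semigroup birth death t) ≤ ENNReal.ofReal (Real.exp (-κ * t))} σ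

end

end BirthDeath

namespace BirthDeath

noncomputable section

/-! ### Killed path kernels -/

/-! Write ∂g(x) = g(x+1) - g(x). The theorem rests on an intertwining ∂P_t f = S_t ∂f for
nondecreasing f, where S_t has birth rates λ_{x+1}, death rates ν_x and total rate λ_x + ν_{x+1};
the difference between total rate and jump rate, a killing rate of arbitrary sign, is the price of
commuting ∂ with the generator. Conjugating S_t by u (a Doob transform) gives the modified chain
with potential V_u, so ∂P_tρ / u is exactly the Feynman-Kac expectation (`pathSum_sum_range_succ`,
`pathSum_doob`, `weight_mul_feynmanKac`). Since S_t is positive, P_t preserves monotonicity. If f is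
1-Lipschitz then ρ + f and ρ - f are nondecreasing, hence |∂P_t f| ≤ ∂P_tρ; as Lipschitz seminorms
are read off from neighbours, the operator norm is attained at ρ.

No generator theory is needed. Every semigroup is a sum, over the number of jumps, of [0,∞]-valued
convolutions of exponentials (`pathSum`), and is the least solution of its backward equation.
`lintegral_process` identifies these sums with expectations over the explicit jump process.

It is enough to prove the intertwining for indicators of (y, ∞). With Q_t(x) the kernel of S_t from
x to y, put H_t(x) = ∑_{z<x} Q_t(z) + λ_0 ∫_0^t Q_s(0) ds. Summing the integrated backward equations
of Q over z < x telescopes to a flux identity (`sum_incrSum_flux`), which says that H solves the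
backward equation of x ↦ ℙ_x(X_t > y). Path reversal bounds ∑_x Q_t(x) by 1, so H is bounded on
bounded times, and non-explosion makes bounded solutions unique (`le_pathSum_of_subsolution`).

For the curvature, V_u ≥ inf V_u bounds the Feynman-Kac expectation by e^{-t inf V_u}. Conversely,
the paths from x with at most one jump give a lower bound whose derivative at t = 0 is -V_u(x), so
an admissible constant cannot exceed any V_u(x). -/

/-- The function `t ↦ e^{-a t}` on `[0, ∞)`, extended by zero. -/
def expo (a t : ℝ) : ℝ≥0∞ := if 0 ≤ t then ENNReal.ofReal (Real.exp (-a * t)) else 0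

@[fun_prop]
lemma measurable_expo (a : ℝ) : Measurable (expo a) :=
  Measurable.ite measurableSet_Ici (by fun_prop) measurable_const

lemma expo_of_neg (a : ℝ) {t : ℝ} (ht : t < 0) : expo a t = 0 := if_neg (not_le.2 ht)

lemma expo_of_nonneg (a : ℝ) {t : ℝ} (ht : 0 ≤ t) :
    expo a t = ENNReal.ofReal (Real.exp (-a * t)) := if_pos ht

lemma expo_zero_of_nonneg {t : ℝ} (ht : 0 ≤ t) : expo 0 t = 1 := by simp [expo_of_nonneg 0 ht]

lemma expo_zero_le_one (t : ℝ) : expo 0 t ≤ 1 := by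
  rcases le_or_gt 0 t with ht | ht
  · exact (expo_zero_of_nonneg ht).le
  · simp [expo_of_neg 0 ht]

/-! ### Convolution of nonnegative functions of time -/

lemma lconv_apply (f g : ℝ → ℝ≥0∞) (t : ℝ) : (f ⋆ₗ g) t = ∫⁻ s, f s * g (-s + t) := rfl

lemma lconv_add_right {f g h : ℝ → ℝ≥0∞} (hf : Measurable f) (hg : Measurable g) (t : ℝ) :
    (f ⋆ₗ fun s => g s + h s) t = (f ⋆ₗ g) t + (f ⋆ₗ h) t := by
  simp only [lconv_apply, mul_add]
  exact lintegral_add_left (by fun_prop) _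

lemma lconv_add_left {f g h : ℝ → ℝ≥0∞} (hf : Measurable f) (hh : Measurable h) (t : ℝ) :
    ((fun s => f s + g s) ⋆ₗ h) t = (f ⋆ₗ h) t + (g ⋆ₗ h) t := by
  simp only [lconv_apply, add_mul]
  exact lintegral_add_left (by fun_prop) _

lemma lconv_smul_right {f g : ℝ → ℝ≥0∞} (hf : Measurable f) (hg : Measurable g) (c : ℝ≥0∞) (t : ℝ) :
    (f ⋆ₗ fun s => c * g s) t = c * (f ⋆ₗ g) t := by
  simp only [lconv_apply]
  rw [← lintegral_const_mul _ (by fun_prop)]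
  exact lintegral_congr fun s => by ring

lemma lconv_smul_left {f g : ℝ → ℝ≥0∞} (hf : Measurable f) (hg : Measurable g) (c : ℝ≥0∞) (t : ℝ) :
    ((fun s => c * f s) ⋆ₗ g) t = c * (f ⋆ₗ g) t := by
  simp only [lconv_apply]
  rw [← lintegral_const_mul _ (by fun_prop)]
  exact lintegral_congr fun s => by ring

lemma lconv_tsum_right {ι : Type*} [Countable ι] {f : ℝ → ℝ≥0∞} {g : ι → ℝ → ℝ≥0∞}
    (hf : Measurable f) (hg : ∀ i, Measurable (g i)) (t : ℝ) :
    (f ⋆ₗ fun s => ∑' i, g i s) t = ∑' i, (f ⋆ₗ g i) t := by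
  simp only [lconv_apply, ← ENNReal.tsum_mul_left]
  exact lintegral_tsum fun i =>
    (hf.mul ((hg i).comp (measurable_neg.add_const t))).aemeasurable

lemma lconv_mono {f g h : ℝ → ℝ≥0∞} {t : ℝ} (hf : ∀ s < 0, f s = 0)
    (hgh : ∀ s ≤ t, g s ≤ h s) : (f ⋆ₗ g) t ≤ (f ⋆ₗ h) t := by
  refine lintegral_mono fun s => ?_
  rcases lt_or_ge s 0 with hs | hs
  · simp [hf s hs]
  · exact mul_le_mul_right (hgh _ (by linarith)) _

lemma lconv_of_neg {f g : ℝ → ℝ≥0∞} (hf : ∀ s < 0, f s = 0) (hg : ∀ s < 0, g s = 0) {t : ℝ}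
    (ht : t < 0) : (f ⋆ₗ g) t = 0 := by
  rw [lconv_apply, ← lintegral_zero]
  refine lintegral_congr fun s => ?_
  rcases lt_or_ge s 0 with hs | hs
  · simp [hf s hs]
  · simp [hg (-s + t) (by linarith)]

/-- The resolvent identity for exponential functions. -/
lemma expo_eq_add_lconv {a b : ℝ} (hab : b ≤ a) (t : ℝ) :
    expo b t = expo a t + ENNReal.ofReal (a - b) * (expo a ⋆ₗ expo b) t := by
  rcases hab.eq_or_lt with rfl | hab
  · simp
  rcases lt_or_ge t 0 with ht | ht
  · rw [expo_of_neg _ ht, expo_of_neg _ ht,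
      lconv_of_neg (fun s hs => expo_of_neg _ hs) (fun s hs => expo_of_neg _ hs) ht]
    simp
  have hr : 0 < a - b := sub_pos.2 hab
  -- Factoring e^{-bt} out of the convolution leaves the exponential density of rate a - b, so the
  -- integral is a distribution function.
  have key : ENNReal.ofReal (a - b) * (expo a ⋆ₗ expo b) t =
      ENNReal.ofReal (Real.exp (-b * t)) *
        ∫⁻ s in Iic t, exponentialPDF (a - b) s := by
    rw [lconv_apply, ← lintegral_const_mul _ (by fun_prop), ← lintegral_indicator measurableSet_Iic,
      ← lintegral_const_mul]
    · refine lintegral_congr fun s => ?_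
      by_cases hst : s ≤ t
      · rw [indicator_of_mem (by exact hst), exponentialPDF_eq]
        by_cases hs : 0 ≤ s
        · rw [expo_of_nonneg _ hs, expo_of_nonneg _ (by linarith), if_pos hs,
            ← ENNReal.ofReal_mul (Real.exp_nonneg _), ← ENNReal.ofReal_mul (Real.exp_nonneg _),
            ← ENNReal.ofReal_mul hr.le]
          congr 1
          rw [← Real.exp_add, mul_left_comm, ← Real.exp_add]
          ring_nf
        · rw [expo_of_neg _ (not_le.1 hs), if_neg hs]; simp
      · rw [indicator_of_notMem (by exact hst), expo_of_neg b (by linarith)]; simp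
    · exact Measurable.indicator (measurable_exponentialPDFReal _).ennreal_ofReal measurableSet_Iic
  rw [key, lintegral_exponentialPDF_eq_antiDeriv hr, if_pos ht, expo_of_nonneg _ ht,
    expo_of_nonneg _ ht, ← ENNReal.ofReal_mul (Real.exp_nonneg _),
    ← ENNReal.ofReal_add (Real.exp_nonneg _)]
  · congr 1
    rw [mul_sub, ← Real.exp_add]
    ring_nf
  · refine mul_nonneg (Real.exp_nonneg _) (sub_nonneg.2 (Real.exp_le_one_iff.2 ?_))
    nlinarith [mul_nonneg hr.le ht]

lemma lconv_expo_zero_le (f : ℝ → ℝ≥0∞) (hf0 : ∀ s < 0, f s = 0) {t : ℝ} {C : ℝ≥0∞}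
    (hf : ∀ s ≤ t, f s ≤ C) : (expo 0 ⋆ₗ f) t ≤ C * ENNReal.ofReal t := by
  calc (expo 0 ⋆ₗ f) t ≤ ∫⁻ s, (Icc 0 t).indicator (fun _ => C) s := by
        refine lintegral_mono fun s => ?_
        rcases lt_or_ge s 0 with hs | hs
        · simp [expo_of_neg 0 hs]
        · by_cases hst : s ≤ t
          · rw [indicator_of_mem (by exact ⟨hs, hst⟩), expo_zero_of_nonneg hs, one_mul]
            exact hf _ (by linarith)
          · simp [hf0 (-s + t) (by linarith)]
    _ = C * ENNReal.ofReal t := by simp [lintegral_indicator]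

/-- Variation of constants gives the integrated equation. -/
lemma add_lconv_eq_of_eq {a : ℝ} (ha : 0 ≤ a) {c : ℝ≥0∞} {v g : ℝ → ℝ≥0∞} (hg : Measurable g)
    (h : ∀ t, v t = c * expo a t + (expo a ⋆ₗ g) t) (t : ℝ) :
    v t + ENNReal.ofReal a * (expo 0 ⋆ₗ v) t = c * expo 0 t + (expo 0 ⋆ₗ g) t := by
  have hv : v = fun t => c * expo a t + (expo a ⋆ₗ g) t := funext h
  have hgm : Measurable (expo a ⋆ₗ g) := measurable_lconvolution _ (measurable_expo a) hg
  have h1 : expo 0 = fun s => expo a s + ENNReal.ofReal a * (expo 0 ⋆ₗ expo a) s := by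
    funext s
    rw [lconvolution_comm]
    simpa using expo_eq_add_lconv ha s
  have h2 : (expo 0 ⋆ₗ g) t =
      (expo a ⋆ₗ g) t + ENNReal.ofReal a * (expo 0 ⋆ₗ (expo a ⋆ₗ g)) t := by
    conv_lhs => rw [h1]
    rw [lconv_add_left (measurable_expo a) hg,
      lconv_smul_left (measurable_lconvolution _ (measurable_expo 0) (measurable_expo a)) hg,
      lconvolution_assoc (measurable_expo 0) (measurable_expo a) hg]
  have h3 : (expo 0 ⋆ₗ v) t =
      c * (expo 0 ⋆ₗ expo a) t + (expo 0 ⋆ₗ (expo a ⋆ₗ g)) t := by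
    rw [hv, lconv_add_right (measurable_expo 0) (by fun_prop),
      lconv_smul_right (measurable_expo 0) (measurable_expo a)]
  rw [h3, h2, h t]
  conv_rhs => rw [congrFun h1 t]
  ring

/-- The integrated equation is equivalent to variation of constants. -/
lemma eq_of_add_lconv_eq {a : ℝ} (ha : 0 ≤ a) {c : ℝ≥0∞} {v g : ℝ → ℝ≥0∞} (hv : Measurable v)
    (hg : Measurable g) (hfin : ∀ t, (expo 0 ⋆ₗ v) t ≠ ∞)
    (h : ∀ t, v t + ENNReal.ofReal a * (expo 0 ⋆ₗ v) t = c * expo 0 t + (expo 0 ⋆ₗ g) t)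
    (t : ℝ) : v t = c * expo a t + (expo a ⋆ₗ g) t := by
  set w : ℝ → ℝ≥0∞ := fun t => c * expo a t + (expo a ⋆ₗ g) t with hw
  have hgm : Measurable (expo a ⋆ₗ g) := measurable_lconvolution _ (measurable_expo a) hg
  have hwm : Measurable w := by fun_prop
  have h1 : expo 0 = fun s => expo a s + ENNReal.ofReal a * (expo a ⋆ₗ expo 0) s := by
    funext s
    simpa using expo_eq_add_lconv ha s
  -- Convolving the integrated equation with `expo a` shows that v and w have the same time
  -- integral. Since w satisfies the same integrated equation, v = w follows by cancelling this
  -- integral, which is where `hfin` enters.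
  have hconv : ∀ t, (expo 0 ⋆ₗ v) t = (expo 0 ⋆ₗ w) t := by
    intro t
    have e1 : (expo 0 ⋆ₗ v) t =
        (expo a ⋆ₗ fun s => v s + ENNReal.ofReal a * (expo 0 ⋆ₗ v) s) t := by
      rw [lconv_add_right (measurable_expo a) hv, lconv_smul_right (measurable_expo a)
        (measurable_lconvolution _ (measurable_expo 0) hv),
        lconvolution_assoc (measurable_expo a) (measurable_expo 0) hv]
      conv_lhs => rw [h1]
      rw [lconv_add_left (measurable_expo a) hv, lconv_smul_left
        (measurable_lconvolution _ (measurable_expo a) (measurable_expo 0)) hv]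
    rw [e1, funext h, lconv_add_right (measurable_expo a) (by fun_prop),
      lconv_smul_right (measurable_expo a) (measurable_expo 0), hw,
      lconv_add_right (measurable_expo 0) (by fun_prop),
      lconv_smul_right (measurable_expo 0) (measurable_expo a),
      lconvolution_comm (f := expo 0) (g := expo a),
      lconvolution_assoc (measurable_expo a) (measurable_expo 0) hg,
      lconvolution_assoc (measurable_expo 0) (measurable_expo a) hg,
      lconvolution_comm (f := expo 0) (g := expo a)]
  have h2 := add_lconv_eq_of_eq ha hg (v := w) (c := c) (fun _ => rfl) t
  rw [← hconv, ← h t] at h2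
  exact ((ENNReal.add_left_inj (ENNReal.mul_ne_top ENNReal.ofReal_ne_top (hfin t))).1 h2).symm

/-- The contribution of the paths with exactly `n` jumps to the semigroup applied to `φ` of the
chain with birth rates `b`, death rates `d` and total rate (including killing) `a`. -/
def pathKernel (b d a : ℕ → ℝ) (φ : ℕ → ℝ≥0∞) : ℕ → ℕ → ℝ → ℝ≥0∞
  | 0, x => fun t => φ x * expo (a x) t
  | n + 1, x => expo (a x) ⋆ₗ fun t =>
      ENNReal.ofReal (b x) * pathKernel b d a φ n (x + 1) t +
        ENNReal.ofReal (d x) * pathKernel b d a φ n (x - 1) t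

/-- The semigroup with birth rates `b`, death rates `d` and total rate `a`, applied to `φ`. -/
def pathSum (b d a : ℕ → ℝ) (φ : ℕ → ℝ≥0∞) (x : ℕ) (t : ℝ) : ℝ≥0∞ :=
  ∑' n, pathKernel b d a φ n x t

section PathKernel

variable {b d a : ℕ → ℝ} {φ : ℕ → ℝ≥0∞}

@[fun_prop]
lemma measurable_pathKernel (n x : ℕ) : Measurable (pathKernel b d a φ n x) := by
  induction n generalizing x with
  | zero => unfold pathKernel; fun_prop
  | succ n ih =>
    refine measurable_lconvolution _ (measurable_expo _) ?_
    exact ((ih _).const_mul _).add ((ih _).const_mul _)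

@[fun_prop]
lemma measurable_pathSum (x : ℕ) : Measurable (pathSum b d a φ x) :=
  Measurable.tsum fun n => measurable_pathKernel n x

lemma pathKernel_of_neg (n x : ℕ) {t : ℝ} (ht : t < 0) : pathKernel b d a φ n x t = 0 := by
  induction n generalizing x t with
  | zero => simp [pathKernel, expo_of_neg _ ht]
  | succ n ih =>
    exact lconv_of_neg (fun s hs => expo_of_neg _ hs) (fun s hs => by simp [ih _ hs]) ht

lemma pathSum_of_neg (x : ℕ) {t : ℝ} (ht : t < 0) : pathSum b d a φ x t = 0 := by
  simp [pathSum, pathKernel_of_neg _ _ ht]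

/-- The backward equation. -/
lemma pathSum_eq (x : ℕ) (t : ℝ) :
    pathSum b d a φ x t = φ x * expo (a x) t + (expo (a x) ⋆ₗ fun t =>
      ENNReal.ofReal (b x) * pathSum b d a φ (x + 1) t +
        ENNReal.ofReal (d x) * pathSum b d a φ (x - 1) t) t := by
  rw [pathSum, tsum_eq_zero_add' ENNReal.summable]
  congr 1
  simp only [pathSum, ← ENNReal.tsum_mul_left]
  simp_rw [← ENNReal.tsum_add]
  rw [lconv_tsum_right (measurable_expo _) (fun n => by fun_prop)]
  rfl

/-- The backward equation for the partial sums. -/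
lemma sum_pathKernel_succ (N x : ℕ) (t : ℝ) :
    ∑ n ∈ Finset.range (N + 1), pathKernel b d a φ n x t =
      φ x * expo (a x) t + (expo (a x) ⋆ₗ fun t =>
      ENNReal.ofReal (b x) * ∑ n ∈ Finset.range N, pathKernel b d a φ n (x + 1) t +
        ENNReal.ofReal (d x) * ∑ n ∈ Finset.range N, pathKernel b d a φ n (x - 1) t) t := by
  induction N with
  | zero => simp [pathKernel, lconv_apply]
  | succ N ih =>
    rw [Finset.sum_range_succ, ih, add_assoc]
    congr 1
    rw [pathKernel, ← lconv_add_right (measurable_expo _) (by fun_prop)]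
    congr 1
    funext s
    rw [Finset.sum_range_succ, Finset.sum_range_succ]
    ring

/-- The path sum is the smallest solution of the backward equation. -/
lemma pathSum_le_of_supersolution {H : ℕ → ℝ → ℝ≥0∞}
    (hH : ∀ x t, φ x * expo (a x) t + (expo (a x) ⋆ₗ fun t =>
      ENNReal.ofReal (b x) * H (x + 1) t + ENNReal.ofReal (d x) * H (x - 1) t) t ≤ H x t)
    (x : ℕ) (t : ℝ) : pathSum b d a φ x t ≤ H x t := by
  rw [pathSum, ENNReal.tsum_eq_iSup_nat]
  refine iSup_le fun N => ?_
  induction N generalizing x t with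
  | zero => simp
  | succ N ih =>
    rw [sum_pathKernel_succ]
    refine le_trans ?_ (hH x t)
    gcongr
    refine lconv_mono (fun s hs => expo_of_neg _ hs) fun s _ => ?_
    gcongr
    · exact ih _ _
    · exact ih _ _

/-- The killing rate a - b - d is at least m (possibly negative), so by the resolvent identity
e^{-mt} is a supersolution of the backward equation; minimality concludes. -/
lemma pathSum_one_le_expo {m : ℝ} (hb : ∀ x, 0 ≤ b x) (hd : ∀ x, 0 ≤ d x)
    (hm : ∀ x, b x + d x ≤ a x - m) (x : ℕ) (t : ℝ) :
    pathSum b d a (fun _ => 1) x t ≤ expo m t := by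
  refine pathSum_le_of_supersolution (H := fun _ => expo m) (fun x t => ?_) x t
  have h0 := hm x
  have h1 := hb x
  have h2 := hd x
  rw [expo_eq_add_lconv (show m ≤ a x by linarith) t, one_mul]
  simp_rw [← add_mul]
  rw [lconv_smul_right (measurable_expo _) (measurable_expo _), ← ENNReal.ofReal_add h1 h2]
  gcongr

lemma pathKernel_tsum {ι : Type*} [Countable ι] (φ : ι → ℕ → ℝ≥0∞) (n x : ℕ) (t : ℝ) :
    pathKernel b d a (fun y => ∑' i, φ i y) n x t = ∑' i, pathKernel b d a (φ i) n x t := by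
  induction n generalizing x t with
  | zero => simp [pathKernel, ENNReal.tsum_mul_right]
  | succ n ih =>
    simp only [pathKernel, ih]
    rw [← lconv_tsum_right (measurable_expo _) (fun n => by fun_prop)]
    simp_rw [ENNReal.tsum_add, ENNReal.tsum_mul_left]

lemma pathSum_tsum {ι : Type*} [Countable ι] (φ : ι → ℕ → ℝ≥0∞) (x : ℕ) (t : ℝ) :
    pathSum b d a (fun y => ∑' i, φ i y) x t = ∑' i, pathSum b d a (φ i) x t := by
  simp only [pathSum, pathKernel_tsum]
  exact ENNReal.tsum_comm

lemma pathKernel_mul_left (c : ℝ≥0∞) (n x : ℕ) (t : ℝ) :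
    pathKernel b d a (fun y => c * φ y) n x t = c * pathKernel b d a φ n x t := by
  induction n generalizing x t with
  | zero => simp [pathKernel, mul_assoc]
  | succ n ih =>
    simp only [pathKernel, ih]
    rw [← lconv_smul_right (measurable_expo _) (by fun_prop)]
    congr 1
    funext s
    ring

lemma pathSum_mul_left (c : ℝ≥0∞) (x : ℕ) (t : ℝ) :
    pathSum b d a (fun y => c * φ y) x t = c * pathSum b d a φ x t := by
  simp only [pathSum, pathKernel_mul_left, ENNReal.tsum_mul_left]

lemma pathSum_eq_tsum_single (φ : ℕ → ℝ≥0∞) (x : ℕ) (t : ℝ) :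
    pathSum b d a φ x t = ∑' y, φ y * pathSum b d a (Pi.single y 1) x t := by
  simp_rw [← pathSum_mul_left, ← pathSum_tsum]
  congr 1
  funext z
  rw [tsum_eq_single z (fun y hy => by simp [hy.symm])]
  simp

/-- The Doob transform of a path kernel by a positive function `u`. -/
lemma pathKernel_doob {u : ℕ → ℝ} (hu : ∀ x, 0 < u x) {b' d' : ℕ → ℝ}
    (hb : ∀ x, u x * b' x = b x * u (x + 1)) (hd : ∀ x, u x * d' x = d x * u (x - 1))
    (n x : ℕ) (t : ℝ) :
    ENNReal.ofReal (u x) * pathKernel b' d' a φ n x t =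
      pathKernel b d a (fun y => ENNReal.ofReal (u y) * φ y) n x t := by
  induction n generalizing x t with
  | zero => simp [pathKernel, mul_assoc]
  | succ n ih =>
    rw [pathKernel, pathKernel, ← lconv_smul_right (measurable_expo _) (by fun_prop)]
    congr 1
    funext s
    rw [← ih, ← ih, ← mul_assoc (ENNReal.ofReal (b x)), ← mul_assoc (ENNReal.ofReal (d x)),
      ← ENNReal.ofReal_mul' (hu _).le, ← ENNReal.ofReal_mul' (hu _).le, ← hb, ← hd,
      ENNReal.ofReal_mul (hu _).le, ENNReal.ofReal_mul (hu _).le]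
    ring

lemma pathSum_doob {u : ℕ → ℝ} (hu : ∀ x, 0 < u x) {b' d' : ℕ → ℝ}
    (hb : ∀ x, u x * b' x = b x * u (x + 1)) (hd : ∀ x, u x * d' x = d x * u (x - 1))
    (x : ℕ) (t : ℝ) :
    ENNReal.ofReal (u x) * pathSum b' d' a φ x t =
      pathSum b d a (fun y => ENNReal.ofReal (u y) * φ y) x t := by
  simp only [pathSum, ← ENNReal.tsum_mul_left, pathKernel_doob hu hb hd]

end PathKernel

/-! ### Duality -/

lemma lconv_left_comm {f g h : ℝ → ℝ≥0∞} (hf : Measurable f) (hg : Measurable g)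
    (hh : Measurable h) : (f ⋆ₗ (g ⋆ₗ h)) = (g ⋆ₗ (f ⋆ₗ h)) := by
  rw [lconvolution_assoc hf hg hh, lconvolution_comm (f := f) (g := g),
    ← lconvolution_assoc hg hf hh]

/-- Reversing the paths exchanges a path kernel with the one of the transposed rates. -/
lemma pathKernel_single_comm {b d a b' d' : ℕ → ℝ} (hb : ∀ x, b x = d' (x + 1))
    (hd : ∀ x, d (x + 1) = b' x) (hd0 : d 0 = 0) (hd0' : d' 0 = 0) (n x y : ℕ) :
    pathKernel b d a (Pi.single y 1) n x = pathKernel b' d' a (Pi.single x 1) n y := by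
  -- The recursion only peels off first jumps, while reversal turns a first jump into a last one. So
  -- the first jump is peeled at x, the kernel is reversed, and a first jump is peeled at y: both
  -- ends are removed at once, and n + 2 reduces to n.
  induction n using Nat.twoStepInduction generalizing x y with
  | zero =>
    by_cases h : x = y
    · subst h; rfl
    · funext t; simp [pathKernel, h, Ne.symm h]
  | one =>
    funext t
    simp only [pathKernel]
    by_cases h1 : y = x + 1
    · subst h1
      have e1 : x - 1 ≠ x + 1 := by omega
      have e2 : x + 1 + 1 ≠ x := by omega
      simp only [Pi.single_apply, e1, e2, if_true, if_false, zero_mul, mul_zero, add_zero, one_mul,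
        zero_add, Nat.add_sub_cancel, hb]
      rw [lconv_smul_right (by fun_prop) (by fun_prop), lconv_smul_right (by fun_prop)
        (by fun_prop), lconvolution_comm]
    · by_cases h2 : x = y + 1
      · subst h2
        have e1 : y - 1 ≠ y + 1 := by omega
        have e2 : y + 1 + 1 ≠ y := by omega
        simp only [Pi.single_apply, e1, e2, if_true, if_false, zero_mul, mul_zero, add_zero,
          one_mul, zero_add, Nat.add_sub_cancel, hd]
        rw [lconv_smul_right (by fun_prop) (by fun_prop), lconv_smul_right (by fun_prop)
          (by fun_prop), lconvolution_comm]
      -- The condition `c 0 = 0` excludes the spurious match i = j = 0 produced by the truncated 0 -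
      -- 1 = 0.
      · have aux : ∀ (c : ℕ → ℝ) (i j : ℕ), c 0 = 0 → i ≠ j + 1 →
            ENNReal.ofReal (c i) * (Pi.single j (1 : ℝ≥0∞) : ℕ → ℝ≥0∞) (i - 1) = 0 := by
          intro c i j hc hij
          rcases Nat.eq_zero_or_pos i with rfl | hi
          · simp [hc]
          · have : i - 1 ≠ j := by omega
            simp [this]
        simp only [← mul_assoc, aux d x y hd0 h2, aux d' y x hd0' h1]
        simp [Ne.symm h1, Ne.symm h2, lconv_apply]
  | more n ih0 ih1 =>
    have key : ∀ (b d a : ℕ → ℝ) (x : ℕ) (c : ℝ) (g₁ g₂ : ℝ → ℝ≥0∞), Measurable g₁ →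
        Measurable g₂ →
        (fun t => ENNReal.ofReal (b x) * (expo c ⋆ₗ g₁) t + ENNReal.ofReal (d x) *
          (expo c ⋆ₗ g₂) t) =
        expo c ⋆ₗ fun t => ENNReal.ofReal (b x) * g₁ t + ENNReal.ofReal (d x) * g₂ t := by
      intro b d a x c g₁ g₂ h1 h2
      funext t
      rw [lconv_add_right (by fun_prop) (by fun_prop), lconv_smul_right (by fun_prop) h1,
        lconv_smul_right (by fun_prop) h2]
    calc pathKernel b d a (Pi.single y 1) (n + 2) x
        = expo (a x) ⋆ₗ fun t =>
          ENNReal.ofReal (b x) * pathKernel b' d' a (Pi.single (x + 1) 1) (n + 1) y t +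
          ENNReal.ofReal (d x) * pathKernel b' d' a (Pi.single (x - 1) 1) (n + 1) y t := by
          rw [pathKernel, ih1, ih1]
      _ = expo (a x) ⋆ₗ (expo (a y) ⋆ₗ fun t => ENNReal.ofReal (b x) *
            (ENNReal.ofReal (b' y) * pathKernel b' d' a (Pi.single (x + 1) 1) n (y + 1) t +
              ENNReal.ofReal (d' y) * pathKernel b' d' a (Pi.single (x + 1) 1) n (y - 1) t) +
          ENNReal.ofReal (d x) *
            (ENNReal.ofReal (b' y) * pathKernel b' d' a (Pi.single (x - 1) 1) n (y + 1) t +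
              ENNReal.ofReal (d' y) * pathKernel b' d' a (Pi.single (x - 1) 1) n (y - 1) t)) := by
          simp only [pathKernel]
          rw [key b d a x _ _ _ (by fun_prop) (by fun_prop)]
      _ = expo (a y) ⋆ₗ (expo (a x) ⋆ₗ fun t => ENNReal.ofReal (b' y) *
            (ENNReal.ofReal (b x) * pathKernel b d a (Pi.single (y + 1) 1) n (x + 1) t +
              ENNReal.ofReal (d x) * pathKernel b d a (Pi.single (y + 1) 1) n (x - 1) t) +
          ENNReal.ofReal (d' y) *
            (ENNReal.ofReal (b x) * pathKernel b d a (Pi.single (y - 1) 1) n (x + 1) t +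
              ENNReal.ofReal (d x) * pathKernel b d a (Pi.single (y - 1) 1) n (x - 1) t)) := by
          rw [lconv_left_comm (by fun_prop) (by fun_prop) (by fun_prop)]
          congr 2
          funext t
          simp only [ih0]
          ring
      _ = expo (a y) ⋆ₗ fun t =>
          ENNReal.ofReal (b' y) * pathKernel b d a (Pi.single (y + 1) 1) (n + 1) x t +
          ENNReal.ofReal (d' y) * pathKernel b d a (Pi.single (y - 1) 1) (n + 1) x t := by
          simp only [pathKernel]
          rw [key b' d' a y _ _ _ (by fun_prop) (by fun_prop)]
      _ = pathKernel b' d' a (Pi.single x 1) (n + 2) y := by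
          conv_rhs => rw [pathKernel]
          rw [ih1, ih1]

lemma pathSum_single_comm {b d a b' d' : ℕ → ℝ} (hb : ∀ x, b x = d' (x + 1))
    (hd : ∀ x, d (x + 1) = b' x) (hd0 : d 0 = 0) (hd0' : d' 0 = 0) (x y : ℕ) (t : ℝ) :
    pathSum b d a (Pi.single y 1) x t = pathSum b' d' a (Pi.single x 1) y t := by
  simp only [pathSum, pathKernel_single_comm hb hd hd0 hd0']

/-! ### Uniqueness for conservative rates -/

/-- With `pathSum_le_of_supersolution` this gives uniqueness of bounded solutions. Conservativity
says that paths with infinitely many jumps carry no mass, which is the only place where a bounded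
solution could exceed the minimal one. -/
lemma le_pathSum_of_subsolution {b d a : ℕ → ℝ} {φ : ℕ → ℝ≥0∞}
    (hcons : ∀ x t, 0 ≤ t → pathSum b d a (fun _ => 1) x t = 1) {H : ℕ → ℝ → ℝ≥0∞} {T : ℝ}
    {C : ℝ≥0∞} (hC : C ≠ ∞) (hneg : ∀ x t, t < 0 → H x t = 0) (hbdd : ∀ x t, t ≤ T → H x t ≤ C)
    (hH : ∀ x t, H x t ≤ φ x * expo (a x) t + (expo (a x) ⋆ₗ fun t =>
      ENNReal.ofReal (b x) * H (x + 1) t + ENNReal.ofReal (d x) * H (x - 1) t) t)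
    (x : ℕ) {t : ℝ} (ht : t ≤ T) : H x t ≤ pathSum b d a φ x t := by
  rcases lt_or_ge t 0 with ht0 | ht0
  · simp [hneg x t ht0]
  -- Iterating the inequality N times leaves C times the mass of the paths with at least N jumps,
  -- the tail of a series with sum 1.
  have key : ∀ N x t, t ≤ T → H x t ≤ ∑ n ∈ Finset.range N, pathKernel b d a φ n x t +
      C * ∑' n, pathKernel b d a (fun _ => 1) (n + N) x t := by
    intro N
    induction N with
    | zero =>
      intro x t ht
      rcases lt_or_ge t 0 with ht0 | ht0
      · simp [hneg x t ht0]
      · have := hcons x t ht0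
        rw [pathSum] at this
        simpa [this] using hbdd x t ht
    | succ N ih =>
      intro x t ht
      refine (hH x t).trans ?_
      rw [sum_pathKernel_succ, add_assoc]
      gcongr
      have e : ∑' n, pathKernel b d a (fun _ => 1) (n + (N + 1)) x t =
          (expo (a x) ⋆ₗ fun t => ENNReal.ofReal (b x) *
            ∑' n, pathKernel b d a (fun _ => 1) (n + N) (x + 1) t + ENNReal.ofReal (d x) *
            ∑' n, pathKernel b d a (fun _ => 1) (n + N) (x - 1) t) t := by
        simp_rw [← ENNReal.tsum_mul_left, ← ENNReal.tsum_add]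
        rw [lconv_tsum_right (measurable_expo _) (fun n => by fun_prop)]
        rfl
      have hm : ∀ x, Measurable fun t => ∑' n, pathKernel b d a (fun _ => 1) (n + N) x t :=
        fun x => Measurable.tsum fun n => measurable_pathKernel _ x
      have hm1 := hm (x + 1)
      have hm2 := hm (x - 1)
      rw [e, ← lconv_smul_right (by fun_prop) (by fun_prop),
        ← lconv_add_right (by fun_prop) (by fun_prop)]
      refine lconv_mono (fun s hs => expo_of_neg _ hs) fun s hs => ?_
      refine (add_le_add (mul_le_mul_right (ih (x + 1) s (hs.trans ht)) _)
        (mul_le_mul_right (ih (x - 1) s (hs.trans ht)) _)).trans (le_of_eq ?_)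
      ring
  have hlim : Tendsto (fun N => pathSum b d a φ x t +
      C * ∑' n, pathKernel b d a (fun _ => 1) (n + N) x t) atTop
      (𝓝 (pathSum b d a φ x t + C * 0)) := by
    refine tendsto_const_nhds.add (ENNReal.Tendsto.const_mul ?_ (Or.inr hC))
    refine ENNReal.tendsto_sum_nat_add (fun n => pathKernel b d a (fun _ => 1) n x t) ?_
    have := hcons x t ht0
    rw [pathSum] at this
    simp [this]
  rw [mul_zero, add_zero] at hlim
  refine ge_of_tendsto' hlim fun N => (key N x t ht).trans ?_
  gcongr
  exact ENNReal.sum_le_tsum _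

/-! ### Intertwining -/

section Intertwining

variable {birth death : ℕ → ℝ}

/-- The semigroup with birth rates `birth (x + 1)`, death rates `death x` and total rate
`birth x + death (x + 1)`, which governs the increments of the birth-death semigroup. -/
def incrSum (birth death : ℕ → ℝ) (φ : ℕ → ℝ≥0∞) : ℕ → ℝ → ℝ≥0∞ :=
  pathSum (fun x => birth (x + 1)) death (fun x => birth x + death (x + 1)) φ

@[fun_prop]
lemma measurable_incrSum (φ : ℕ → ℝ≥0∞) (x : ℕ) : Measurable (incrSum birth death φ x) :=
  measurable_pathSum x

/-- Column sums become row sums for the reversed chain. That chain has births `death (y + 1)` and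
deaths `birth y`, which exhaust the total rate except at 0, where `birth 0` is left over as killing.
Hence its mass is at most 1, even though the original kernel may create mass. -/
lemma tsum_incrSum_single_le (hbirth : ∀ x, 0 ≤ birth x) (hdeath0 : death 0 = 0)
    (hdeath : ∀ x, 0 ≤ death x) (y : ℕ) (t : ℝ) :
    ∑' x, incrSum birth death (Pi.single y 1) x t ≤ 1 := by
  set d' : ℕ → ℝ := fun y => if y = 0 then 0 else birth y with hd'
  have h1 : ∀ x, incrSum birth death (Pi.single y 1) x t =
      pathSum (fun y => death (y + 1)) d' (fun x => birth x + death (x + 1)) (Pi.single x 1) y t :=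
    fun x => pathSum_single_comm (by simp [hd']) (fun _ => rfl) hdeath0 (by simp [hd']) x y t
  have h2 := pathSum_eq_tsum_single (b := fun y => death (y + 1)) (d := d')
    (a := fun x => birth x + death (x + 1)) (fun _ => 1) y t
  simp only [one_mul] at h2
  simp_rw [h1]
  rw [← h2]
  refine (pathSum_one_le_expo (m := 0) (fun x => hdeath _) (fun x => ?_) (fun x => ?_) y t).trans
    (expo_zero_le_one t)
  · simp only [hd']; split_ifs
    · exact le_rfl
    · exact hbirth x
  · simp only [hd']; split_ifs <;> linarith [hbirth x]

lemma sum_incrSum_single_le (hbirth : ∀ x, 0 ≤ birth x) (hdeath0 : death 0 = 0)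
    (hdeath : ∀ x, 0 ≤ death x) (y : ℕ) (s : Finset ℕ) (t : ℝ) :
    ∑ x ∈ s, incrSum birth death (Pi.single y 1) x t ≤ 1 :=
  (ENNReal.sum_le_tsum s).trans (tsum_incrSum_single_le hbirth hdeath0 hdeath y t)

lemma incrSum_single_le (hbirth : ∀ x, 0 ≤ birth x) (hdeath0 : death 0 = 0)
    (hdeath : ∀ x, 0 ≤ death x) (y x : ℕ) (t : ℝ) :
    incrSum birth death (Pi.single y 1) x t ≤ 1 := by
  simpa using sum_incrSum_single_le hbirth hdeath0 hdeath y {x} t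

lemma lconv_incrSum_ne_top (hbirth : ∀ x, 0 ≤ birth x) (hdeath0 : death 0 = 0)
    (hdeath : ∀ x, 0 ≤ death x) (y x : ℕ) (t : ℝ) :
    (expo 0 ⋆ₗ incrSum birth death (Pi.single y 1) x) t ≠ ∞ :=
  ((lconv_expo_zero_le _ (fun _ hs => pathSum_of_neg x hs)
    (fun s _ => incrSum_single_le hbirth hdeath0 hdeath y x s)).trans_lt (by simp)).ne

/-- The flux equation: the integrated equation for the increments, summed over `z < x`. -/
lemma sum_incrSum_flux (hbirth : ∀ x, 0 ≤ birth x) (hdeath0 : death 0 = 0)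
    (hdeath : ∀ x, 0 ≤ death x) (y x : ℕ) (t : ℝ) :
    ∑ z ∈ Finset.range x, incrSum birth death (Pi.single y 1) z t +
        ENNReal.ofReal (birth 0) * (expo 0 ⋆ₗ incrSum birth death (Pi.single y 1) 0) t +
        ENNReal.ofReal (death x) * (expo 0 ⋆ₗ incrSum birth death (Pi.single y 1) (x - 1)) t =
      (if y < x then 1 else 0) * expo 0 t +
        ENNReal.ofReal (birth x) * (expo 0 ⋆ₗ incrSum birth death (Pi.single y 1) x) t := by
  induction x with
  | zero => simp [hdeath0]
  | succ x ih =>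
    have hx := add_lconv_eq_of_eq (a := birth x + death (x + 1))
      (add_nonneg (hbirth _) (hdeath _)) (by fun_prop)
      (fun t => pathSum_eq (b := fun x => birth (x + 1)) (d := death)
        (a := fun x => birth x + death (x + 1)) (φ := Pi.single y 1) x t) t
    change _ + _ * (expo 0 ⋆ₗ incrSum birth death (Pi.single y 1) x) t =
      _ + (expo 0 ⋆ₗ fun t =>
        ENNReal.ofReal (birth (x + 1)) * incrSum birth death (Pi.single y 1) (x + 1) t +
        ENNReal.ofReal (death x) * incrSum birth death (Pi.single y 1) (x - 1) t) t at hx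
    rw [lconv_add_right (by fun_prop) (by fun_prop), lconv_smul_right (by fun_prop) (by fun_prop),
      lconv_smul_right (by fun_prop) (by fun_prop), ENNReal.ofReal_add (hbirth _) (hdeath _)] at hx
    change incrSum birth death (Pi.single y 1) x t + _ = _ at hx
    have hfin := lconv_incrSum_ne_top hbirth hdeath0 hdeath y
    -- These two flux terms appear on both sides when `ih` and `hx` are added; being finite, they
    -- cancel in [0,∞].
    have hK : ENNReal.ofReal (death x) * (expo 0 ⋆ₗ incrSum birth death (Pi.single y 1) (x - 1)) t
        + ENNReal.ofReal (birth x) * (expo 0 ⋆ₗ incrSum birth death (Pi.single y 1) x) t ≠ ∞ :=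
      ENNReal.add_ne_top.2 ⟨ENNReal.mul_ne_top ENNReal.ofReal_ne_top (hfin _ t),
        ENNReal.mul_ne_top ENNReal.ofReal_ne_top (hfin _ t)⟩
    have hind : (if y < x + 1 then (1 : ℝ≥0∞) else 0) =
        (if y < x then 1 else 0) + (Pi.single y 1 : ℕ → ℝ≥0∞) x := by
      rcases lt_trichotomy y x with h | h | h
      · simp [h, h.trans (Nat.lt_succ_self x), h.ne']
      · simp [h]
      · simp [h.ne, not_lt.2 h.le, show ¬ y < x + 1 by omega]
    rw [← ENNReal.add_left_inj hK, Finset.sum_range_succ, hind, Nat.add_sub_cancel]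
    have := congrArg₂ (· + ·) ih hx
    convert this using 1 <;> ring

/-- Intertwining for indicators: the increments of `x ↦ ℙ_x(X_t > y)`. -/
lemma pathSum_indicator_succ (hbirth : ∀ x, 0 ≤ birth x) (hdeath0 : death 0 = 0)
    (hdeath : ∀ x, 0 ≤ death x)
    (hcons : ∀ x t, 0 ≤ t →
      pathSum birth death (fun x => birth x + death x) (fun _ => 1) x t = 1)
    (y x : ℕ) (t : ℝ) :
    pathSum birth death (fun x => birth x + death x) (fun z => if y < z then 1 else 0) (x + 1) t =
      pathSum birth death (fun x => birth x + death x) (fun z => if y < z then 1 else 0) x t +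
        incrSum birth death (Pi.single y 1) x t := by
  set Q := incrSum birth death (Pi.single y 1) with hQ
  have hQm : ∀ x, Measurable (Q x) := fun x => measurable_incrSum _ x
  have hQ0 : ∀ x s, s < 0 → Q x s = 0 := fun x s hs => pathSum_of_neg x hs
  have hIm : Measurable (expo 0 ⋆ₗ Q 0) := measurable_lconvolution _ (measurable_expo 0) (hQm 0)
  -- The candidate for ℙ_x(X_t > y). Its value at x = 0 is forced: at 0 the backward equation has
  -- time derivative λ_0 (H(1) - H(0)) = λ_0 Q(0), with initial value 0.
  set H : ℕ → ℝ → ℝ≥0∞ := fun x t =>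
    ∑ z ∈ Finset.range x, Q z t + ENNReal.ofReal (birth 0) * (expo 0 ⋆ₗ Q 0) t with hH
  have hHm : ∀ x, Measurable (H x) := fun x => by fun_prop
  have hHneg : ∀ x t, t < 0 → H x t = 0 := by
    intro x t ht
    simp [hH, hQ0 _ t ht, lconv_of_neg (fun s hs => expo_of_neg 0 hs) (hQ0 0) ht]
  have hHbdd : ∀ T x t, t ≤ T → H x t ≤ 1 + ENNReal.ofReal (birth 0) * ENNReal.ofReal T := by
    intro T x t ht
    refine add_le_add (sum_incrSum_single_le hbirth hdeath0 hdeath y _ t) ?_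
    refine mul_le_mul_right ?_ _
    refine (lconv_expo_zero_le _ (hQ0 0)
      (fun s _ => incrSum_single_le hbirth hdeath0 hdeath y 0 s)).trans ?_
    rw [one_mul]
    exact ENNReal.ofReal_le_ofReal ht
  have hsucc : ∀ x t, H (x + 1) t = H x t + Q x t := by
    intro x t
    simp only [hH, Finset.sum_range_succ]
    ring
  have hIsucc : ∀ x t, (expo 0 ⋆ₗ H (x + 1)) t = (expo 0 ⋆ₗ H x) t + (expo 0 ⋆ₗ Q x) t := by
    intro x t
    rw [← lconv_add_right (by fun_prop) (hHm x)]
    exact congrArg (fun f => (expo 0 ⋆ₗ f) t) (funext fun s => hsucc x s)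
  have hHeq : ∀ x t, H x t = (if y < x then 1 else 0) * expo (birth x + death x) t +
      (expo (birth x + death x) ⋆ₗ fun t =>
        ENNReal.ofReal (birth x) * H (x + 1) t + ENNReal.ofReal (death x) * H (x - 1) t) t := by
    intro x
    have hm1 := hHm (x + 1)
    have hm2 := hHm (x - 1)
    refine eq_of_add_lconv_eq (add_nonneg (hbirth x) (hdeath x)) (hHm x) (by fun_prop)
      (fun t => ?_) (fun t => ?_)
    · refine ((lconv_expo_zero_le _ (hHneg x) (hHbdd t x)).trans_lt ?_).ne
      exact ENNReal.mul_lt_top (ENNReal.add_lt_top.2 ⟨ENNReal.one_lt_top,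
        ENNReal.mul_lt_top ENNReal.ofReal_lt_top ENNReal.ofReal_lt_top⟩) ENNReal.ofReal_lt_top
    · rw [lconv_add_right (g := fun t => ENNReal.ofReal (birth x) * H (x + 1) t) (by fun_prop)
        (by fun_prop), lconv_smul_right (by fun_prop) hm1,
        lconv_smul_right (by fun_prop) hm2, hIsucc, ENNReal.ofReal_add (hbirth x) (hdeath x)]
      have hflux := sum_incrSum_flux hbirth hdeath0 hdeath y x t
      change H x t + ENNReal.ofReal (death x) * (expo 0 ⋆ₗ Q (x - 1)) t =
        _ + ENNReal.ofReal (birth x) * (expo 0 ⋆ₗ Q x) t at hflux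
      -- At x = 0 the truncated x - 1 is again 0, and the identity survives only because `death 0 =
      -- 0`.
      have hpred : ENNReal.ofReal (death x) * (expo 0 ⋆ₗ H x) t =
          ENNReal.ofReal (death x) * (expo 0 ⋆ₗ H (x - 1)) t +
            ENNReal.ofReal (death x) * (expo 0 ⋆ₗ Q (x - 1)) t := by
        cases x with
        | zero => simp [hdeath0]
        | succ x => rw [Nat.add_sub_cancel, hIsucc, mul_add]
      rw [add_mul, hpred]
      have := congrArg (· + (ENNReal.ofReal (birth x) * (expo 0 ⋆ₗ H x) t +
        ENNReal.ofReal (death x) * (expo 0 ⋆ₗ H (x - 1)) t)) hflux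
      convert this using 1 <;> ring
  have hHF : ∀ x t, H x t = pathSum birth death (fun x => birth x + death x)
      (fun z => if y < z then 1 else 0) x t := by
    intro x t
    -- One inequality is minimality; the other needs conservativity and the boundedness of H.
    refine le_antisymm ?_ (pathSum_le_of_supersolution (fun x t => (hHeq x t).ge) x t)
    exact le_pathSum_of_subsolution hcons (ENNReal.add_lt_top.2 ⟨ENNReal.one_lt_top,
        ENNReal.mul_lt_top ENNReal.ofReal_lt_top ENNReal.ofReal_lt_top⟩).ne hHneg
        (hHbdd t) (fun x t => (hHeq x t).le) x le_rfl
  rw [← hHF, ← hHF, hsucc]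

/-- Intertwining: the increments of the semigroup applied to a function with increments `w`. -/
lemma pathSum_sum_range_succ (hbirth : ∀ x, 0 ≤ birth x) (hdeath0 : death 0 = 0)
    (hdeath : ∀ x, 0 ≤ death x)
    (hcons : ∀ x t, 0 ≤ t →
      pathSum birth death (fun x => birth x + death x) (fun _ => 1) x t = 1)
    (w : ℕ → ℝ≥0∞) (x : ℕ) (t : ℝ) :
    pathSum birth death (fun x => birth x + death x) (fun z => ∑ y ∈ Finset.range z, w y)
        (x + 1) t =
      pathSum birth death (fun x => birth x + death x) (fun z => ∑ y ∈ Finset.range z, w y) x t +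
        incrSum birth death w x t := by
  -- Layer-cake decomposition: by countable additivity in φ, only indicators of (y, ∞) matter.
  have hw : (fun z => ∑ y ∈ Finset.range z, w y) =
      fun z => ∑' y, w y * (if y < z then 1 else 0) := by
    funext z
    rw [tsum_eq_sum (s := Finset.range z) (fun y hy => by simp_all)]
    exact Finset.sum_congr rfl fun y hy => by simp_all
  rw [incrSum, pathSum_eq_tsum_single w, hw]
  simp only [pathSum_tsum, pathSum_mul_left]
  rw [← ENNReal.tsum_add]
  simp only [pathSum_indicator_succ hbirth hdeath0 hdeath hcons, mul_add]
  rfl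

end Intertwining

/-! ### The driving noise -/

instance isProbabilityMeasure_expMeasure_one : IsProbabilityMeasure (expMeasure 1) :=
  isProbabilityMeasure_expMeasure one_pos

/-- The law of a single (clock, decision) pair. -/
def stepLaw : Measure (ℝ × unitInterval) := (expMeasure 1).prod volume

instance : IsProbabilityMeasure stepLaw := by unfold stepLaw; infer_instance

instance : IsProbabilityMeasure noiseLaw :=
  inferInstanceAs (IsProbabilityMeasure (Measure.infinitePi fun _ : ℕ => stepLaw))

/-- The noise after the first jump. -/
def shift (ω : Noise) : Noise := fun n => ω (n + 1)

@[fun_prop]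
lemma measurable_shift : Measurable shift :=
  measurable_pi_lambda _ fun n => measurable_pi_apply (n + 1)

/-- Prepends a pair to the noise. -/
def cons (p : (ℝ × unitInterval) × Noise) : Noise
  | 0 => p.1
  | n + 1 => p.2 n

lemma measurable_cons : Measurable cons :=
  measurable_pi_lambda _ fun n => match n with
    | 0 => measurable_fst
    | n + 1 => (measurable_pi_apply n).comp measurable_snd

@[simp] lemma cons_zero (p : (ℝ × unitInterval) × Noise) : cons p 0 = p.1 := rfl

@[simp] lemma shift_cons (p : (ℝ × unitInterval) × Noise) : shift (cons p) = p.2 := rfl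

lemma shift_pos {ω : Noise} (hω : ∀ n, 0 < (ω n).1) (n : ℕ) : 0 < (shift ω n).1 := hω (n + 1)

/-- An i.i.d. sequence is its first term followed by an independent copy of itself. It suffices to
test on cylinders, and padding with `univ` makes the index set an initial segment, from which the
factor at 0 splits off. -/
lemma map_cons : (stepLaw.prod noiseLaw).map cons = noiseLaw := by
  refine Measure.eq_infinitePi (fun _ : ℕ => stepLaw) fun s t ht => ?_
  set t' : ℕ → Set (ℝ × unitInterval) := fun i => if i ∈ s then t i else univ with ht'
  have htm : ∀ i, MeasurableSet (t' i) := fun i => by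
    simp only [ht']; split_ifs
    · exact ht i
    · exact .univ
  obtain ⟨N, hN⟩ : ∃ N, s ⊆ Finset.range (N + 1) :=
    ⟨s.sup id, fun i hi => Finset.mem_range.2 (Nat.lt_succ_of_le (Finset.le_sup (f := id) hi))⟩
  have h1 : Set.pi (s : Set ℕ) t = Set.pi (Finset.range (N + 1) : Set ℕ) t' := by
    ext ω
    simp only [Set.mem_pi, Finset.mem_coe, ht']
    constructor
    · intro h i _
      split_ifs with hi
      · exact h i hi
      · trivial
    · intro h i hi
      simpa [hi] using h i (hN hi)
  have h2 : cons ⁻¹' Set.pi (Finset.range (N + 1) : Set ℕ) t' =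
      t' 0 ×ˢ Set.pi (Finset.range N : Set ℕ) fun i => t' (i + 1) := by
    ext p
    simp only [Set.mem_preimage, Set.mem_pi, Finset.mem_coe, Finset.mem_range, Set.mem_prod]
    constructor
    · intro h
      exact ⟨h 0 (by omega), fun i hi => h (i + 1) (by omega)⟩
    · rintro ⟨h0, h⟩ i hi
      cases i with
      | zero => exact h0
      | succ i => exact h i (by omega)
  have h3 : ∏ i ∈ s, stepLaw (t i) = ∏ i ∈ Finset.range (N + 1), stepLaw (t' i) := by
    rw [← Finset.prod_subset hN (fun i _ hi => by simp [ht', hi])]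
    exact Finset.prod_congr rfl fun i hi => by simp [ht', hi]
  rw [h1, h3, Measure.map_apply measurable_cons
    (MeasurableSet.pi (Finset.countable_toSet _) fun i _ => htm i), h2, Measure.prod_prod,
    Finset.prod_range_succ', mul_comm]
  congr 1
  exact Measure.infinitePi_pi (fun _ : ℕ => stepLaw) fun i _ => htm (i + 1)

lemma lintegral_noiseLaw {F : Noise → ℝ≥0∞} (hF : Measurable F) :
    ∫⁻ ω, F ω ∂noiseLaw = ∫⁻ p, ∫⁻ ω, F (cons (p, ω)) ∂noiseLaw ∂stepLaw := by
  conv_lhs => rw [← map_cons]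
  rw [lintegral_map hF measurable_cons]
  exact lintegral_prod _ (hF.comp measurable_cons).aemeasurable

lemma expMeasure_one_eq : expMeasure 1 = volume.withDensity (exponentialPDF 1) := rfl

lemma measurable_exponentialPDF (r : ℝ) : Measurable (exponentialPDF r) :=
  (measurable_exponentialPDFReal r).ennreal_ofReal

lemma exponentialPDF_one_eq_expo : exponentialPDF 1 = expo 1 := by
  funext s
  rw [exponentialPDF_eq, expo]
  split_ifs <;> simp

lemma expMeasure_one_Ioi {c : ℝ} (hc : 0 ≤ c) : expMeasure 1 (Ioi c) = expo 1 c := by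
  have h := prob_compl_eq_one_sub (μ := expMeasure 1) (measurableSet_Iic (a := c))
  rw [compl_Iic] at h
  have hle : Real.exp (-(1 * c)) ≤ 1 := Real.exp_le_one_iff.2 (by linarith)
  rw [h, expMeasure_one_eq, withDensity_apply _ measurableSet_Iic,
    lintegral_exponentialPDF_eq_antiDeriv one_pos, if_pos hc, ← ENNReal.ofReal_one,
    ← ENNReal.ofReal_sub _ (by linarith), expo_of_nonneg _ hc]
  ring_nf

lemma ae_noiseLaw_pos : ∀ᵐ ω ∂noiseLaw, ∀ n, 0 < (ω n).1 := by
  rw [ae_all_iff]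
  intro n
  have h1 : ∀ᵐ e ∂(expMeasure 1), 0 < e := by
    have := expMeasure_one_Ioi le_rfl
    rw [expo_of_nonneg _ le_rfl] at this
    exact (mem_ae_iff_prob_eq_one measurableSet_Ioi).2 (by simpa using this)
  have h2 : ∀ᵐ p ∂stepLaw, 0 < p.1 := Measure.quasiMeasurePreserving_fst.ae h1
  exact (measurePreserving_eval_infinitePi (fun _ : ℕ => stepLaw) n).quasiMeasurePreserving.ae h2

/-- An exponential holding time, rescaled to have rate `r`. -/
lemma lintegral_holding {r : ℝ} (hr : 0 < r) (v : ℝ) {G : ℝ → ℝ≥0∞} (hG : Measurable G) :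
    ∫⁻ e, expo v (e / r) * G (e / r) ∂(expMeasure 1) =
      ENNReal.ofReal r * ∫⁻ s, expo (r + v) s * G s := by
  rw [expMeasure_one_eq, lintegral_withDensity_eq_lintegral_mul _ (measurable_exponentialPDF 1)
    (by fun_prop)]
  -- The substitution e = r s; its Jacobian is the factor r in the claim.
  conv_lhs => rw [← Real.smul_map_volume_mul_left hr.ne']
  rw [lintegral_smul_measure, lintegral_map
    ((measurable_exponentialPDF 1).mul (by fun_prop)) (by fun_prop), abs_of_pos hr, smul_eq_mul]
  congr 1
  refine lintegral_congr fun s => ?_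
  rw [Pi.mul_apply, exponentialPDF_one_eq_expo, mul_div_cancel_left₀ _ hr.ne', ← mul_assoc]
  congr 1
  rcases lt_or_ge s 0 with hs | hs
  · simp [expo_of_neg _ hs]
  · rw [expo_of_nonneg _ hs, expo_of_nonneg _ hs, expo_of_nonneg _ (mul_nonneg hr.le hs),
      ← ENNReal.ofReal_mul (Real.exp_nonneg _), ← Real.exp_add]
    ring_nf

/-! ### The first-jump decomposition -/

section Paths

variable {b d : ℕ → ℝ}

/-- The state reached from `x` when the noise is `p`. -/
def nextState (b d : ℕ → ℝ) (x : ℕ) (p : ℝ × unitInterval) : ℕ :=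
  if (p.2 : ℝ) ≤ b x / (b x + d x) then x + 1 else x - 1

/-- The uniform decision falls below the threshold with probability b / (b + d). The prefactor,
which comes from the holding-time density, turns jump probabilities back into rates. -/
lemma lintegral_nextState (hb : ∀ x, 0 ≤ b x) (hd : ∀ x, 0 ≤ d x) (hbd : ∀ x, 0 < b x + d x)
    (x : ℕ) (e : ℝ) (F : ℕ → ℝ≥0∞) :
    ENNReal.ofReal (b x + d x) * ∫⁻ U : unitInterval, F (nextState b d x (e, U)) =
      ENNReal.ofReal (b x) * F (x + 1) + ENNReal.ofReal (d x) * F (x - 1) := by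
  set q : unitInterval := ⟨b x / (b x + d x), div_nonneg (hb x) (hbd x).le,
    (div_le_one (hbd x)).2 (by linarith [hd x])⟩ with hq
  have h : ∀ U : unitInterval, F (nextState b d x (e, U)) =
      (Iic q).indicator (fun _ => F (x + 1)) U + (Ioi q).indicator (fun _ => F (x - 1)) U := by
    intro U
    by_cases hU : U ≤ q
    · have hU' : (U : ℝ) ≤ b x / (b x + d x) := hU
      simp [nextState, hU, hU', not_lt.2 hU]
    · have hU' : ¬ (U : ℝ) ≤ b x / (b x + d x) := hU
      simp [nextState, hU, hU', not_le.1 hU]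
  simp_rw [h]
  rw [lintegral_add_left (measurable_const.indicator measurableSet_Iic),
    lintegral_indicator measurableSet_Iic, lintegral_indicator measurableSet_Ioi]
  simp only [lintegral_const, Measure.restrict_apply_univ, unitInterval.volume_Iic,
    unitInterval.volume_Ioi]
  have e1 : (b x + d x) * (q : ℝ) = b x := by
    simp only [hq]; field_simp [(hbd x).ne']
  have e2 : (b x + d x) * (1 - (q : ℝ)) = d x := by rw [mul_sub, e1]; ring
  rw [mul_add, mul_left_comm, mul_left_comm _ (F (x - 1)), ← ENNReal.ofReal_mul (hbd x).le,
    ← ENNReal.ofReal_mul (hbd x).le, e1, e2, mul_comm, mul_comm (F (x - 1))]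

/-- The Feynman-Kac weight of the path from `x` up to time `t`, on the event that there are
exactly `n` jumps. -/
def jumpWeight (b d V : ℕ → ℝ) (φ : ℕ → ℝ≥0∞) : ℕ → ℕ → Noise → ℝ → ℝ≥0∞
  | 0, x, ω, t => if t < (ω 0).1 / (b x + d x) then φ x * expo (V x) t else 0
  | n + 1, x, ω, t => expo (V x) ((ω 0).1 / (b x + d x)) *
      jumpWeight b d V φ n (nextState b d x (ω 0)) (shift ω) (t - (ω 0).1 / (b x + d x))

variable {V : ℕ → ℝ} {φ : ℕ → ℝ≥0∞}

lemma measurable_nextState (x : ℕ) : Measurable (nextState b d x) :=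
  Measurable.ite (measurableSet_le (by fun_prop) measurable_const) measurable_const measurable_const

lemma measurable_jumpWeight (n x : ℕ) :
    Measurable fun q : Noise × ℝ => jumpWeight b d V φ n x q.1 q.2 := by
  induction n generalizing x with
  | zero =>
    refine Measurable.ite (measurableSet_lt (by fun_prop) (by fun_prop)) (by fun_prop)
      measurable_const
  | succ n ih =>
    simp only [jumpWeight]
    refine Measurable.mul (by fun_prop) ?_
    have h : Measurable fun z : ℕ × (Noise × ℝ) => jumpWeight b d V φ n z.1 z.2.1 z.2.2 :=
      measurable_from_prod_countable_right fun y => ih y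
    refine h.comp (Measurable.prodMk ((measurable_nextState x).comp (by fun_prop))
      (Measurable.prodMk (by fun_prop) (by fun_prop)))

/-- Conditioning on the first jump: the discount e^{-V s} merges with the holding-time exponential
into total rate b + d + V, and integrating out the decision gives the two terms of the kernel
recursion. -/
lemma lintegral_jumpWeight (hb : ∀ x, 0 ≤ b x) (hd : ∀ x, 0 ≤ d x) (hbd : ∀ x, 0 < b x + d x)
    (n x : ℕ) (t : ℝ) :
    ∫⁻ ω, jumpWeight b d V φ n x ω t ∂noiseLaw =
      pathKernel b d (fun x => b x + d x + V x) φ n x t := by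
  have hm : ∀ n x t, Measurable fun ω => jumpWeight b d V φ n x ω t := fun n x t =>
    (measurable_jumpWeight n x).comp (measurable_id.prodMk measurable_const)
  induction n generalizing x t with
  | zero =>
    rw [lintegral_noiseLaw (hm 0 x t)]
    rw [pathKernel]
    have h1 : ∀ (p : ℝ × unitInterval) (ω : Noise), jumpWeight b d V φ 0 x (cons (p, ω)) t =
        (Ioi ((b x + d x) * t) ×ˢ univ).indicator (fun _ => φ x * expo (V x) t) p := by
      intro p ω
      have : t < p.1 / (b x + d x) ↔ p ∈ Ioi ((b x + d x) * t) ×ˢ (univ : Set unitInterval) := by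
        simp [lt_div_iff₀ (hbd x), mul_comm]
      change (if t < p.1 / (b x + d x) then φ x * expo (V x) t else 0) = _
      simp only [this, indicator_apply]
    simp_rw [h1, lintegral_const, measure_univ, mul_one]
    rcases lt_or_ge t 0 with ht | ht
    · simp [expo_of_neg _ ht]
    rw [lintegral_indicator (measurableSet_Ioi.prod .univ), setLIntegral_const, stepLaw,
      Measure.prod_prod, measure_univ, mul_one,
      expMeasure_one_Ioi (mul_nonneg (hbd x).le ht), mul_assoc,
      expo_of_nonneg _ ht, expo_of_nonneg _ ht, expo_of_nonneg _ (mul_nonneg (hbd x).le ht),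
      ← ENNReal.ofReal_mul (Real.exp_nonneg _), ← Real.exp_add]
    ring_nf
  | succ n ih =>
    rw [lintegral_noiseLaw (hm (n + 1) x t)]
    simp only [jumpWeight, cons_zero, shift_cons]
    have h1 : ∀ p : ℝ × unitInterval, ∫⁻ ω, expo (V x) (p.1 / (b x + d x)) *
        jumpWeight b d V φ n (nextState b d x p) ω (t - p.1 / (b x + d x)) ∂noiseLaw =
        expo (V x) (p.1 / (b x + d x)) * pathKernel b d (fun x => b x + d x + V x) φ n
          (nextState b d x p) (t - p.1 / (b x + d x)) := by
      intro p
      rw [lintegral_const_mul _ (hm _ _ _), ih]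
    simp_rw [h1]
    have hK : Measurable fun z : ℕ × ℝ =>
        pathKernel b d (fun x => b x + d x + V x) φ n z.1 z.2 :=
      measurable_from_prod_countable_right fun y => measurable_pathKernel n y
    have hmeas : Measurable fun p : ℝ × unitInterval => expo (V x) (p.1 / (b x + d x)) *
        pathKernel b d (fun x => b x + d x + V x) φ n (nextState b d x p)
          (t - p.1 / (b x + d x)) :=
      Measurable.mul (by fun_prop) (hK.comp ((measurable_nextState x).prodMk (by fun_prop)))
    rw [stepLaw, lintegral_prod _ hmeas.aemeasurable]
    -- The next state depends only on the decision, so its clock entry may be replaced by 0. This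
    -- isolates a function of the holding time alone, as `lintegral_holding` requires.
    have h2 : ∀ e : ℝ, ∫⁻ U : unitInterval, expo (V x) (e / (b x + d x)) *
        pathKernel b d (fun x => b x + d x + V x) φ n (nextState b d x (e, U))
          (t - e / (b x + d x)) = expo (V x) (e / (b x + d x)) *
        (fun s => ∫⁻ U : unitInterval, pathKernel b d (fun x => b x + d x + V x) φ n
          (nextState b d x (0, U)) (t - s)) (e / (b x + d x)) := by
      intro e
      rw [lintegral_const_mul]
      · rfl
      · exact hK.comp (((measurable_nextState x).comp (by fun_prop)).prodMk measurable_const)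
    have h3 : Measurable fun s => ∫⁻ U : unitInterval,
        pathKernel b d (fun x => b x + d x + V x) φ n (nextState b d x (0, U)) (t - s) := by
      refine Measurable.lintegral_prod_right' (f := fun z : ℝ × unitInterval =>
        pathKernel b d (fun x => b x + d x + V x) φ n (nextState b d x (0, z.2)) (t - z.1)) ?_
      exact hK.comp (((measurable_nextState x).comp (by fun_prop)).prodMk (by fun_prop))
    simp_rw [h2]
    rw [lintegral_holding (hbd x) _ h3, ← lintegral_const_mul _ (by fun_prop), pathKernel,
      lconv_apply]
    refine lintegral_congr fun s => ?_
    rw [mul_left_comm, lintegral_nextState hb hd hbd x 0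
      (fun y => pathKernel b d (fun x => b x + d x + V x) φ n y (t - s))]
    simp only [neg_add_eq_sub]

/-! ### Regeneration of the path at its first jump -/

lemma embeddedChain_succ (x : ℕ) (ω : Noise) (n : ℕ) :
    embeddedChain b d x ω (n + 1) = embeddedChain b d (nextState b d x (ω 0)) (shift ω) n := by
  induction n with
  | zero => rfl
  | succ n ih =>
    rw [embeddedChain, ih]
    rfl

lemma jumpTime_zero (x : ℕ) (ω : Noise) : jumpTime b d x ω 0 = 0 := rfl

lemma jumpTime_succ (x : ℕ) (ω : Noise) (n : ℕ) :
    jumpTime b d x ω (n + 1) = (ω 0).1 / (b x + d x) +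
      jumpTime b d (nextState b d x (ω 0)) (shift ω) n := by
  rw [jumpTime, Finset.sum_range_succ', add_comm]
  simp only [jumpTime, holdingTime, embeddedChain_succ]
  rfl

lemma monotone_jumpTime (hbd : ∀ x, 0 < b x + d x) (x : ℕ) {ω : Noise} (hω : ∀ n, 0 < (ω n).1) :
    Monotone (jumpTime b d x ω) := by
  refine monotone_nat_of_le_succ fun n => ?_
  rw [jumpTime, jumpTime, Finset.sum_range_succ]
  exact le_add_of_nonneg_right (div_nonneg (hω n).le (hbd _).le)

lemma process_of_mem (hbd : ∀ x, 0 < b x + d x) {x : ℕ} {ω : Noise} (hω : ∀ n, 0 < (ω n).1)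
    {n : ℕ} {t : ℝ} (h1 : jumpTime b d x ω n ≤ t) (h2 : t < jumpTime b d x ω (n + 1)) :
    process b d x t ω = some (embeddedChain b d x ω n) := by
  classical
  have h : ∃ n, t < jumpTime b d x ω (n + 1) := ⟨n, h2⟩
  rw [process, dif_pos h]
  congr 2
  rw [Nat.find_eq_iff]
  exact ⟨h2, fun m hm => not_lt.2 ((monotone_jumpTime hbd x hω hm).trans h1)⟩

lemma exists_jumpTime_mem {x : ℕ} {ω : Noise} {t : ℝ} (ht : 0 ≤ t)
    (h : ∃ n, t < jumpTime b d x ω (n + 1)) :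
    ∃ n, jumpTime b d x ω n ≤ t ∧ t < jumpTime b d x ω (n + 1) := by
  classical
  refine ⟨Nat.find h, ?_, Nat.find_spec h⟩
  cases hn : Nat.find h with
  | zero => simpa [jumpTime_zero] using ht
  | succ k => exact not_lt.1 (Nat.find_min h (m := k) (by omega))

lemma process_shift (hbd : ∀ x, 0 < b x + d x) {x : ℕ} {ω : Noise} (hω : ∀ n, 0 < (ω n).1)
    {t : ℝ} (ht : (ω 0).1 / (b x + d x) ≤ t) :
    process b d x t ω =
      process b d (nextState b d x (ω 0)) (t - (ω 0).1 / (b x + d x)) (shift ω) := by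
  classical
  have ht0 : 0 ≤ t - (ω 0).1 / (b x + d x) := sub_nonneg.2 ht
  by_cases h : ∃ n, t - (ω 0).1 / (b x + d x) <
      jumpTime b d (nextState b d x (ω 0)) (shift ω) (n + 1)
  · obtain ⟨n, h1, h2⟩ := exists_jumpTime_mem ht0 h
    rw [process_of_mem hbd (shift_pos hω) h1 h2,
      process_of_mem (n := n + 1) hbd hω (by rw [jumpTime_succ]; linarith)
        (by rw [jumpTime_succ]; linarith), embeddedChain_succ]
  · have h' : ¬ ∃ n, t < jumpTime b d x ω (n + 1) := by
      rintro ⟨n, hn⟩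
      cases n with
      | zero =>
        rw [jumpTime_succ, jumpTime_zero] at hn
        linarith
      | succ n =>
        rw [jumpTime_succ] at hn
        exact h ⟨n, by linarith⟩
    rw [process, process, dif_neg h, dif_neg h']

lemma process_of_lt (hbd : ∀ x, 0 < b x + d x) {x : ℕ} {ω : Noise} (hω : ∀ n, 0 < (ω n).1)
    {t : ℝ} (ht0 : 0 ≤ t) (ht : t < (ω 0).1 / (b x + d x)) : process b d x t ω = some x :=
  process_of_mem (n := 0) hbd hω ht0 (by rwa [jumpTime_succ, jumpTime_zero, add_zero])

lemma jumpWeight_of_neg (hbd : ∀ x, 0 < b x + d x) (n x : ℕ) {ω : Noise}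
    (hω : ∀ n, 0 < (ω n).1) {t : ℝ} (ht : t < 0) : jumpWeight b d V φ n x ω t = 0 := by
  induction n generalizing x ω t with
  | zero => simp [jumpWeight, expo_of_neg _ ht]
  | succ n ih =>
    have := div_pos (hω 0) (hbd x)
    rw [jumpWeight, ih _ (shift_pos hω) (by linarith), mul_zero]

lemma jumpWeight_of_notMem (hbd : ∀ x, 0 < b x + d x) (n x : ℕ) {ω : Noise}
    (hω : ∀ n, 0 < (ω n).1) {t : ℝ}
    (ht : ¬ (jumpTime b d x ω n ≤ t ∧ t < jumpTime b d x ω (n + 1))) :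
    jumpWeight b d V φ n x ω t = 0 := by
  rcases lt_or_ge t 0 with ht0 | ht0
  · exact jumpWeight_of_neg hbd n x hω ht0
  induction n generalizing x ω t with
  | zero =>
    rw [jumpWeight, if_neg]
    intro h
    exact ht ⟨ht0, by rwa [jumpTime_succ, jumpTime_zero, add_zero]⟩
  | succ n ih =>
    rw [jumpWeight]
    rcases lt_or_ge (t - (ω 0).1 / (b x + d x)) 0 with h | h
    · rw [jumpWeight_of_neg hbd n _ (shift_pos hω) h, mul_zero]
    · rw [ih _ (shift_pos hω) (fun hh => ht ?_) h, mul_zero]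
      rw [jumpTime_succ, jumpTime_succ]
      exact ⟨by linarith [hh.1], by linarith [hh.2]⟩

/-- The integral of the potential along the path, up to time `t`. -/
def pathIntegral (b d V : ℕ → ℝ) (x : ℕ) (ω : Noise) (t : ℝ) : ℝ :=
  ∫ s in (0 : ℝ)..t, (process b d x s ω).elim 0 V

/-- The time integral is split at the first jump and the discounts multiply. Integrability travels
with the induction because the splitting needs it on both pieces. -/
lemma jumpWeight_of_mem (hbd : ∀ x, 0 < b x + d x) (n x : ℕ) {ω : Noise}
    (hω : ∀ n, 0 < (ω n).1) {t : ℝ}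
    (h1 : jumpTime b d x ω n ≤ t) (h2 : t < jumpTime b d x ω (n + 1)) :
    IntervalIntegrable (fun s => (process b d x s ω).elim 0 V) volume 0 t ∧
    jumpWeight b d V φ n x ω t = φ (embeddedChain b d x ω n) *
      ENNReal.ofReal (Real.exp (-pathIntegral b d V x ω t)) := by
  induction n generalizing x ω t with
  | zero =>
    rw [jumpTime_zero] at h1
    rw [jumpTime_succ, jumpTime_zero, add_zero] at h2
    have hc : ∀ s ∈ uIcc 0 t, (process b d x s ω).elim 0 V = V x := by
      intro s hs
      rw [uIcc_of_le h1] at hs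
      rw [process_of_lt hbd hω hs.1 (hs.2.trans_lt h2)]
      rfl
    refine ⟨(intervalIntegrable_const (c := V x)).congr fun s hs =>
      (hc s (uIoc_subset_uIcc hs)).symm, ?_⟩
    rw [jumpWeight, if_pos h2, expo_of_nonneg _ h1, pathIntegral,
      intervalIntegral.integral_congr hc]
    simp [embeddedChain, mul_comm]
  | succ n ih =>
    set h := (ω 0).1 / (b x + d x) with hh
    have hpos : 0 < h := div_pos (hω 0) (hbd x)
    rw [jumpTime_succ] at h1 h2
    have hJ : 0 ≤ jumpTime b d (nextState b d x (ω 0)) (shift ω) n :=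
      monotone_jumpTime hbd _ (ω := shift ω) (shift_pos hω) (Nat.zero_le n)
    have hht : h ≤ t := by linarith
    obtain ⟨hint, hW⟩ := ih (nextState b d x (ω 0)) (ω := shift ω) (shift_pos hω)
      (t := t - h) (by linarith) (by linarith)
    have hc : ∀ s ∈ Ioo 0 h, (process b d x s ω).elim 0 V = V x := by
      intro s hs
      rw [process_of_lt hbd hω hs.1.le hs.2]
      rfl
    have hc' : ∀ s ∈ uIcc h t, (process b d x s ω).elim 0 V =
        (process b d (nextState b d x (ω 0)) (s - h) (shift ω)).elim 0 V := by
      intro s hs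
      rw [uIcc_of_le hht] at hs
      rw [process_shift hbd hω hs.1]
    -- At s = h the path has already jumped, so that one instant has to be discarded.
    have hae : ∀ᵐ s ∂(volume : Measure ℝ), s ∈ uIoc 0 h →
        V x = (process b d x s ω).elim 0 V := by
      filter_upwards [Measure.ae_ne volume h] with s hs hs'
      rw [uIoc_of_le hpos.le] at hs'
      exact (hc s ⟨hs'.1, lt_of_le_of_ne hs'.2 hs⟩).symm
    have hint1 : IntervalIntegrable (fun s => (process b d x s ω).elim 0 V) volume 0 h :=
      (intervalIntegrable_const (c := V x)).congr_ae
        ((ae_restrict_iff' measurableSet_uIoc).2 hae)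
    have hint2 : IntervalIntegrable (fun s => (process b d x s ω).elim 0 V) volume h t := by
      have := hint.comp_sub_right h
      rw [zero_add, sub_add_cancel] at this
      exact this.congr fun s hs => (hc' s (uIoc_subset_uIcc hs)).symm
    refine ⟨hint1.trans hint2, ?_⟩
    have hsplit : pathIntegral b d V x ω t = V x * h +
        pathIntegral b d V (nextState b d x (ω 0)) (shift ω) (t - h) := by
      rw [pathIntegral, ← intervalIntegral.integral_add_adjacent_intervals hint1 hint2,
        ← intervalIntegral.integral_congr_ae hae, intervalIntegral.integral_congr hc',
        intervalIntegral.integral_comp_sub_right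
          (fun s => (process b d (nextState b d x (ω 0)) s (shift ω)).elim 0 V)]
      simp [pathIntegral, mul_comm]
    rw [jumpWeight, hW, expo_of_nonneg _ hpos.le, hsplit, embeddedChain_succ, mul_left_comm,
      ← ENNReal.ofReal_mul (Real.exp_nonneg _), ← Real.exp_add]
    ring_nf

lemma tsum_jumpWeight (hbd : ∀ x, 0 < b x + d x) (x : ℕ) {ω : Noise}
    (hω : ∀ n, 0 < (ω n).1) {t : ℝ} (ht : 0 ≤ t) :
    ∑' n, jumpWeight b d V φ n x ω t = (process b d x t ω).elim 0 fun y =>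
      φ y * ENNReal.ofReal (Real.exp (-pathIntegral b d V x ω t)) := by
  by_cases h : ∃ n, t < jumpTime b d x ω (n + 1)
  · obtain ⟨n, h1, h2⟩ := exists_jumpTime_mem ht h
    rw [process_of_mem hbd hω h1 h2, tsum_eq_single n]
    · exact (jumpWeight_of_mem hbd n x hω h1 h2).2
    · intro m hm
      refine jumpWeight_of_notMem hbd m x hω fun ⟨h3, h4⟩ => ?_
      have hmono := monotone_jumpTime hbd x hω
      rcases lt_or_gt_of_ne hm with hm | hm
      · exact absurd (hmono (show m + 1 ≤ n from hm)) (not_le.2 (h1.trans_lt h4))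
      · exact absurd (hmono (show n + 1 ≤ m from hm)) (not_le.2 (h3.trans_lt h2))
  · rw [process, dif_neg h]
    simp only [Option.elim_none, ENNReal.tsum_eq_zero]
    exact fun n => jumpWeight_of_notMem hbd n x hω fun hh => h ⟨n, hh.2⟩

/-- The Feynman-Kac functional of the minimal process is the sum over paths. -/
lemma lintegral_process (hb : ∀ x, 0 ≤ b x) (hd : ∀ x, 0 ≤ d x) (hbd : ∀ x, 0 < b x + d x)
    (V : ℕ → ℝ) (φ : ℕ → ℝ≥0∞) (x : ℕ) {t : ℝ} (ht : 0 ≤ t) :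
    AEMeasurable (fun ω => (process b d x t ω).elim 0 fun y =>
      φ y * ENNReal.ofReal (Real.exp (-pathIntegral b d V x ω t))) noiseLaw ∧
    ∫⁻ ω, ((process b d x t ω).elim 0 fun y =>
      φ y * ENNReal.ofReal (Real.exp (-pathIntegral b d V x ω t))) ∂noiseLaw =
      pathSum b d (fun x => b x + d x + V x) φ x t := by
  have hm : ∀ n, Measurable fun ω => jumpWeight b d V φ n x ω t := fun n =>
    (measurable_jumpWeight n x).comp (measurable_id.prodMk measurable_const)
  have hae : (fun ω => ∑' n, jumpWeight b d V φ n x ω t) =ᵐ[noiseLaw] fun ω =>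
      (process b d x t ω).elim 0 fun y =>
      φ y * ENNReal.ofReal (Real.exp (-pathIntegral b d V x ω t)) := by
    filter_upwards [ae_noiseLaw_pos] with ω hω
    exact tsum_jumpWeight hbd x hω ht
  refine ⟨(Measurable.tsum hm).aemeasurable.congr hae, ?_⟩
  rw [← lintegral_congr_ae hae, lintegral_tsum fun n => (hm n).aemeasurable]
  simp only [lintegral_jumpWeight hb hd hbd, pathSum]

lemma feynmanKac_eq_pathSum (hb : ∀ x, 0 ≤ b x) (hd : ∀ x, 0 ≤ d x) (hbd : ∀ x, 0 < b x + d x)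
    (V : ℕ → ℝ) (x : ℕ) {t : ℝ} (ht : 0 ≤ t) :
    feynmanKac b d V t x = pathSum b d (fun x => b x + d x + V x) (fun _ => 1) x t := by
  rw [← (lintegral_process hb hd hbd V (fun _ => 1) x ht).2, feynmanKac]
  simp only [one_mul]
  rfl

lemma lintegral_process_zero (hb : ∀ x, 0 ≤ b x) (hd : ∀ x, 0 ≤ d x) (hbd : ∀ x, 0 < b x + d x)
    (φ : ℕ → ℝ≥0∞) (x : ℕ) {t : ℝ} (ht : 0 ≤ t) :
    AEMeasurable (fun ω => (process b d x t ω).elim 0 φ) noiseLaw ∧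
    ∫⁻ ω, (process b d x t ω).elim 0 φ ∂noiseLaw =
      pathSum b d (fun x => b x + d x) φ x t := by
  have h := lintegral_process hb hd hbd (fun _ => 0) φ x ht
  have h0 : ∀ ω, pathIntegral b d (fun _ => 0) x ω t = 0 := by
    intro ω
    rw [pathIntegral, show (fun s => (process b d x s ω).elim (0 : ℝ) fun _ => 0) = fun _ => 0 from
      funext fun s => by cases process b d x s ω <;> rfl]
    simp
  simpa [h0] using h

lemma ofReal_transProb (hb : ∀ x, 0 ≤ b x) (hd : ∀ x, 0 ≤ d x) (hbd : ∀ x, 0 < b x + d x)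
    {t : ℝ} (ht : 0 ≤ t) (x y : ℕ) :
    ENNReal.ofReal (transProb b d t x y) =
      pathSum b d (fun x => b x + d x) (Pi.single y 1) x t := by
  obtain ⟨h1, h2⟩ := lintegral_process_zero hb hd hbd (Pi.single y 1) x ht
  have hi : (fun ω => (process b d x t ω).elim 0 (Pi.single y (1 : ℝ≥0∞))) =
      {ω | process b d x t ω = some y}.indicator fun _ => 1 := by
    funext ω
    rcases hp : process b d x t ω with _ | z
    · rw [indicator_of_notMem (by simp [hp])]
      rfl
    · by_cases hz : z = y
      · rw [indicator_of_mem (by simp [hp, hz])]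
        simp [hz]
      · rw [indicator_of_notMem (by simp [hp, hz])]
        simp [hz]
  rw [hi] at h1 h2
  -- The path decomposition holds only for positive clocks, hence almost surely, so null
  -- measurability is what it yields directly.
  have hnull : NullMeasurableSet {ω | process b d x t ω = some y} noiseLaw :=
    (aemeasurable_indicator_const_iff (1 : ℝ≥0∞)).1 h1
  rw [lintegral_indicator_const₀ hnull, one_mul] at h2
  rw [transProb, ofReal_measureReal, h2]

lemma pathSum_one_of_nonExplosive (hb : ∀ x, 0 ≤ b x) (hd : ∀ x, 0 ≤ d x)
    (hbd : ∀ x, 0 < b x + d x) (hne : NonExplosive b d) (x : ℕ) (t : ℝ) (ht : 0 ≤ t) :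
    pathSum b d (fun x => b x + d x) (fun _ => 1) x t = 1 := by
  rw [← (lintegral_process_zero hb hd hbd (fun _ => 1) x ht).2]
  have : ∀ᵐ ω ∂noiseLaw, (process b d x t ω).elim 0 (fun _ => (1 : ℝ≥0∞)) = 1 := by
    filter_upwards [hne x] with ω hω
    obtain ⟨n, hn⟩ := ((tendsto_add_atTop_iff_nat 1).2 hω).eventually_gt_atTop t |>.exists
    rw [process, dif_pos ⟨n, hn⟩]
    rfl
  rw [lintegral_congr_ae this]
  simp

end Paths

/-! ### Lipschitz seminorms -/

section Lipschitz

variable {ρ : ℕ → ℝ}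

lemma weight_pos (hρ : StrictMono ρ) (x : ℕ) : 0 < weight ρ x := sub_pos.2 (hρ (Nat.lt_succ_self x))

/-- The neighbour bounds say exactly that Cρ - g and Cρ + g are nondecreasing. -/
lemma abs_sub_le_weightDist {g : ℕ → ℝ} {C : ℝ} (hρ : StrictMono ρ)
    (h : ∀ x, |g (x + 1) - g x| ≤ C * weight ρ x) (x y : ℕ) :
    |g x - g y| ≤ C * weightDist ρ x y := by
  have h1 : Monotone fun x => C * ρ x - g x := monotone_nat_of_le_succ fun x => by
    have := (abs_le.1 (h x)).2
    simp only [weight] at this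
    linarith
  have h2 : Monotone fun x => C * ρ x + g x := monotone_nat_of_le_succ fun x => by
    have := (abs_le.1 (h x)).1
    simp only [weight] at this
    linarith
  wlog hxy : x ≤ y generalizing x y
  · have := this y x (le_of_not_ge hxy)
    rwa [abs_sub_comm, weightDist, abs_sub_comm (ρ y)] at this
  have e1 := h1 hxy
  have e2 := h2 hxy
  simp only at e1 e2
  rw [weightDist, abs_sub_comm (ρ x), abs_of_nonneg (sub_nonneg.2 (hρ.monotone hxy)), abs_le]
  constructor <;> linarith

lemma weightDist_succ (hρ : StrictMono ρ) (x : ℕ) : weightDist ρ (x + 1) x = weight ρ x :=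
  abs_of_pos (weight_pos hρ x)

/-- The Lipschitz seminorm is determined by nearest neighbours. -/
lemma lipNorm_eq_iSup (hρ : StrictMono ρ) (g : ℕ → ℝ) :
    lipNorm (weightDist ρ) g = ⨆ x, ENNReal.ofReal (|g (x + 1) - g x| / weight ρ x) := by
  apply le_antisymm
  · set S := ⨆ x, ENNReal.ofReal (|g (x + 1) - g x| / weight ρ x) with hS
    rcases eq_or_ne S ∞ with hT | hT
    · rw [hT]; exact le_top
    have h : ∀ x, |g (x + 1) - g x| ≤ S.toReal * weight ρ x := by
      intro x
      rw [← div_le_iff₀ (weight_pos hρ x)]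
      exact (ENNReal.ofReal_le_iff_le_toReal hT).1
        (le_iSup (fun x => ENNReal.ofReal (|g (x + 1) - g x| / weight ρ x)) x)
    refine iSup_le fun x => iSup_le fun y => iSup_le fun hxy => ?_
    rw [ENNReal.ofReal_le_iff_le_toReal hT, div_le_iff₀]
    · exact abs_sub_le_weightDist hρ h x y
    · exact abs_pos.2 (sub_ne_zero.2 (hρ.injective.ne hxy))
  · refine iSup_le fun x => ?_
    rw [← weightDist_succ hρ]
    exact le_iSup_of_le (x + 1) (le_iSup_of_le x (le_iSup_of_le (Nat.succ_ne_self x) le_rfl))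

lemma abs_sub_le_weight_of_lipNorm_le (hρ : StrictMono ρ) {g : ℕ → ℝ}
    (h : lipNorm (weightDist ρ) g ≤ 1) (x : ℕ) : |g (x + 1) - g x| ≤ weight ρ x := by
  rw [lipNorm_eq_iSup hρ] at h
  have := (le_iSup (fun x => ENNReal.ofReal (|g (x + 1) - g x| / weight ρ x)) x).trans h
  rwa [← ENNReal.ofReal_one, ENNReal.ofReal_le_ofReal_iff zero_le_one,
    div_le_one (weight_pos hρ x)] at this

lemma lipNorm_weightDist_self (hρ : StrictMono ρ) : lipNorm (weightDist ρ) ρ ≤ 1 := by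
  rw [lipNorm_eq_iSup hρ]
  refine iSup_le fun x => ?_
  rw [show ρ (x + 1) - ρ x = weight ρ x from rfl, abs_of_pos (weight_pos hρ x),
    div_self (weight_pos hρ x).ne', ENNReal.ofReal_one]

end Lipschitz

/-! ### The semigroup -/

section Semigroup

variable {birth death ρ : ℕ → ℝ}

lemma hasSum_transProb (hb : ∀ x, 0 ≤ birth x) (hd : ∀ x, 0 ≤ death x)
    (hbd : ∀ x, 0 < birth x + death x) (hne : NonExplosive birth death) {t : ℝ} (ht : 0 ≤ t)
    (x : ℕ) : HasSum (transProb birth death t x) 1 := by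
  have hnn : ∀ y, 0 ≤ transProb birth death t x y := fun y => measureReal_nonneg
  have h : ∑' y, ENNReal.ofReal (transProb birth death t x y) = 1 := by
    have := pathSum_eq_tsum_single (b := birth) (d := death) (a := fun x => birth x + death x)
      (fun _ => 1) x t
    simp only [one_mul, pathSum_one_of_nonExplosive hb hd hbd hne x t ht] at this
    simp_rw [ofReal_transProb hb hd hbd ht, ← this]
  have hs : Summable (transProb birth death t x) := by
    have := ENNReal.summable_toReal (h.trans_ne ENNReal.one_ne_top)
    simpa only [ENNReal.toReal_ofReal (hnn _)] using this
  rw [hs.hasSum_iff, ← ENNReal.ofReal_eq_one, ENNReal.ofReal_tsum_of_nonneg hnn hs, h]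

lemma ofReal_semigroup (hb : ∀ x, 0 ≤ birth x) (hd : ∀ x, 0 ≤ death x)
    (hbd : ∀ x, 0 < birth x + death x) {t : ℝ} (ht : 0 ≤ t) {g : ℕ → ℝ} (hg : ∀ y, 0 ≤ g y)
    (x : ℕ) (hs : Summable fun y => g y * transProb birth death t x y) :
    ENNReal.ofReal (semigroup birth death t g x) =
      pathSum birth death (fun x => birth x + death x) (fun y => ENNReal.ofReal (g y)) x t := by
  rw [semigroup, ENNReal.ofReal_tsum_of_nonneg
    (f := fun y => g y * transProb birth death t x y)
    (fun y => mul_nonneg (hg y) measureReal_nonneg) hs, pathSum_eq_tsum_single]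
  simp_rw [ENNReal.ofReal_mul (hg _), ofReal_transProb hb hd hbd ht]

/-- Intertwining of the semigroup with the difference operator, for monotone functions. -/
lemma semigroup_succ_sub (hb : ∀ x, 0 ≤ birth x) (hd : ∀ x, 0 ≤ death x)
    (hd0 : death 0 = 0) (hbd : ∀ x, 0 < birth x + death x) (hne : NonExplosive birth death)
    {t : ℝ} (ht : 0 ≤ t) {g : ℕ → ℝ} (hg : Monotone g)
    (hs : ∀ x, Summable fun y => g y * transProb birth death t x y) (x : ℕ) :
    semigroup birth death t g x ≤ semigroup birth death t g (x + 1) ∧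
    ENNReal.ofReal (semigroup birth death t g (x + 1) - semigroup birth death t g x) =
      incrSum birth death (fun y => ENNReal.ofReal (g (y + 1) - g y)) x t := by
  -- Normalizing at 0 makes g nonnegative and equal to the cumulative sum of its increments, as
  -- needed for [0,∞]-valued path sums. Non-explosion ensures that the constant g 0 passes through
  -- the semigroup unchanged.
  set g' : ℕ → ℝ := fun y => g y - g 0 with hg'
  have hnn : ∀ y, 0 ≤ g' y := fun y => sub_nonneg.2 (hg (Nat.zero_le y))
  have hP := hasSum_transProb hb hd hbd hne ht
  have hs' : ∀ x, Summable fun y => g' y * transProb birth death t x y := fun x => by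
    simpa only [hg', sub_mul] using (hs x).sub ((hP x).summable.mul_left (g 0))
  have hsub : ∀ x, semigroup birth death t g' x = semigroup birth death t g x - g 0 := by
    intro x
    simp only [semigroup, hg', sub_mul]
    rw [(hs x).tsum_sub ((hP x).summable.mul_left (g 0)), tsum_mul_left, (hP x).tsum_eq, mul_one]
  have hpos : ∀ x, 0 ≤ semigroup birth death t g' x := fun x =>
    tsum_nonneg fun y => mul_nonneg (hnn y) measureReal_nonneg
  have hcum : (fun y => ENNReal.ofReal (g' y)) =
      fun z => ∑ y ∈ Finset.range z, ENNReal.ofReal (g (y + 1) - g y) := by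
    funext z
    rw [← ENNReal.ofReal_sum_of_nonneg fun y _ => sub_nonneg.2 (hg (Nat.le_succ y)),
      Finset.sum_range_sub]
  have key : ENNReal.ofReal (semigroup birth death t g' (x + 1)) =
      ENNReal.ofReal (semigroup birth death t g' x) +
        incrSum birth death (fun y => ENNReal.ofReal (g (y + 1) - g y)) x t := by
    rw [ofReal_semigroup hb hd hbd ht hnn _ (hs' _), ofReal_semigroup hb hd hbd ht hnn _ (hs' _),
      hcum]
    exact pathSum_sum_range_succ hb hd0 hd (pathSum_one_of_nonExplosive hb hd hbd hne) _ x t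
  have hle : semigroup birth death t g' x ≤ semigroup birth death t g' (x + 1) :=
    (ENNReal.ofReal_le_ofReal_iff (hpos _)).1 (key ▸ le_self_add)
  refine ⟨by simpa [hsub] using hle, ?_⟩
  rw [show semigroup birth death t g (x + 1) - semigroup birth death t g x =
    semigroup birth death t g' (x + 1) - semigroup birth death t g' x by simp [hsub],
    ENNReal.ofReal_sub _ (hpos x), key]
  exact ENNReal.add_sub_cancel_left ENNReal.ofReal_ne_top

lemma summable_of_lipschitz (hb : ∀ x, 0 ≤ birth x) (hd : ∀ x, 0 ≤ death x)
    (hbd : ∀ x, 0 < birth x + death x) (hne : NonExplosive birth death) (hρ : StrictMono ρ)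
    {t : ℝ} (ht : 0 ≤ t) {x : ℕ}
    (hmoment : FiniteMoment (weightDist ρ) (transProb birth death t x))
    {f : ℕ → ℝ} (hf : ∀ x, |f (x + 1) - f x| ≤ weight ρ x) :
    Summable fun y => f y * transProb birth death t x y := by
  obtain ⟨x₀, h⟩ := hmoment
  refine Summable.of_norm_bounded
    (h.add ((hasSum_transProb hb hd hbd hne ht x).summable.mul_left |f x₀|)) fun y => ?_
  have hP : 0 ≤ transProb birth death t x y := measureReal_nonneg
  rw [Real.norm_eq_abs, abs_mul, abs_of_nonneg hP, ← add_mul]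
  refine mul_le_mul_of_nonneg_right ?_ hP
  have h1 := abs_sub_le_weightDist (C := 1) hρ (fun z => by simpa using hf z) y x₀
  have h2 := abs_sub_abs_le_abs_sub (f y) (f x₀)
  linarith

/-- The increments of `P_t f` are dominated by those of `P_t ρ`. -/
lemma abs_semigroup_succ_sub_le (hb : ∀ x, 0 ≤ birth x) (hd : ∀ x, 0 ≤ death x)
    (hd0 : death 0 = 0) (hbd : ∀ x, 0 < birth x + death x) (hne : NonExplosive birth death)
    (hρ : StrictMono ρ) {t : ℝ} (ht : 0 ≤ t)
    (hmoment : ∀ x, FiniteMoment (weightDist ρ) (transProb birth death t x))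
    {f : ℕ → ℝ} (hf : ∀ x, |f (x + 1) - f x| ≤ weight ρ x) (x : ℕ) :
    |semigroup birth death t f (x + 1) - semigroup birth death t f x| ≤
      |semigroup birth death t ρ (x + 1) - semigroup birth death t ρ x| := by
  have hsf := fun x => summable_of_lipschitz hb hd hbd hne hρ ht (hmoment x) hf
  have hsρ := fun x => summable_of_lipschitz hb hd hbd hne hρ ht (hmoment x) (f := ρ)
    (fun x => (abs_of_pos (weight_pos hρ x)).le)
  have hadd : ∀ x, semigroup birth death t (fun y => ρ y + f y) x =
      semigroup birth death t ρ x + semigroup birth death t f x := fun x => by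
    simp only [semigroup, add_mul]
    exact (hsρ x).tsum_add (hsf x)
  have hsub : ∀ x, semigroup birth death t (fun y => ρ y - f y) x =
      semigroup birth death t ρ x - semigroup birth death t f x := fun x => by
    simp only [semigroup, sub_mul]
    exact (hsρ x).tsum_sub (hsf x)
  -- Both ρ + f and ρ - f are nondecreasing and remain so under the semigroup; together this bounds
  -- the increment of f from below and above.
  have h1 := (semigroup_succ_sub hb hd hd0 hbd hne ht (g := fun y => ρ y + f y)
    (monotone_nat_of_le_succ fun z => by
      have := (abs_le.1 (hf z)).1
      simp only [weight] at this
      linarith) (fun x => by simpa only [add_mul] using (hsρ x).add (hsf x)) x).1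
  have h2 := (semigroup_succ_sub hb hd hd0 hbd hne ht (g := fun y => ρ y - f y)
    (monotone_nat_of_le_succ fun z => by
      have := (abs_le.1 (hf z)).2
      simp only [weight] at this
      linarith) (fun x => by simpa only [sub_mul] using (hsρ x).sub (hsf x)) x).1
  rw [hadd, hadd] at h1
  rw [hsub, hsub] at h2
  refine le_trans (abs_le.2 ⟨?_, ?_⟩) (le_abs_self _) <;> linarith

/-- The Lipschitz operator norm of the semigroup is attained at `ρ`. -/
lemma lipOpNorm_semigroup (hb : ∀ x, 0 ≤ birth x) (hd : ∀ x, 0 ≤ death x)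
    (hd0 : death 0 = 0) (hbd : ∀ x, 0 < birth x + death x) (hne : NonExplosive birth death)
    (hρ : StrictMono ρ) {t : ℝ} (ht : 0 ≤ t)
    (hmoment : ∀ x, FiniteMoment (weightDist ρ) (transProb birth death t x)) :
    lipOpNorm (weightDist ρ) (semigroup birth death t) =
      lipNorm (weightDist ρ) (semigroup birth death t ρ) := by
  refine le_antisymm (iSup_le fun f => iSup_le fun hf => ?_)
    (le_iSup_of_le ρ (le_iSup_of_le (lipNorm_weightDist_self hρ) le_rfl))
  rw [lipNorm_eq_iSup hρ, lipNorm_eq_iSup hρ]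
  refine iSup_mono fun x => ENNReal.ofReal_le_ofReal ?_
  exact div_le_div_of_nonneg_right (abs_semigroup_succ_sub_le hb hd hd0 hbd hne hρ ht hmoment
    (abs_sub_le_weight_of_lipNorm_le hρ hf) x) (weight_pos hρ x).le

/-! ### The modified process -/

lemma modBirth_pos (hbirth : ∀ x, 0 < birth x) (hρ : StrictMono ρ) (x : ℕ) :
    0 < modBirth birth (weight ρ) x :=
  mul_pos (div_pos (weight_pos hρ _) (weight_pos hρ _)) (hbirth _)

lemma modDeath_nonneg (hdeath : ∀ x, 0 ≤ death x) (hρ : StrictMono ρ) (x : ℕ) :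
    0 ≤ modDeath death (weight ρ) x :=
  mul_nonneg (div_pos (weight_pos hρ _) (weight_pos hρ _)).le (hdeath _)

/-- This is what fixes the form of the potential: jumping plus killing must have the total rate of
the increment semigroup, since a Doob transform leaves total rates unchanged. -/
lemma modBirth_add_modDeath_add_potential (u : ℕ → ℝ) (x : ℕ) :
    modBirth birth u x + modDeath death u x + potential birth death u x =
      birth x + death (x + 1) := by
  rw [potential]; ring

lemma feynmanKac_mod_eq_pathSum (hbirth : ∀ x, 0 < birth x) (hdeath : ∀ x, 0 ≤ death x)
    (hρ : StrictMono ρ) {t : ℝ} (ht : 0 ≤ t) (x : ℕ) :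
    feynmanKac (modBirth birth (weight ρ)) (modDeath death (weight ρ))
      (potential birth death (weight ρ)) t x =
    pathSum (modBirth birth (weight ρ)) (modDeath death (weight ρ))
      (fun x => birth x + death (x + 1)) (fun _ => 1) x t := by
  rw [feynmanKac_eq_pathSum (fun x => (modBirth_pos hbirth hρ x).le) (modDeath_nonneg hdeath hρ)
    (fun x => add_pos_of_pos_of_nonneg (modBirth_pos hbirth hρ x) (modDeath_nonneg hdeath hρ x))
    _ x ht]
  simp only [modBirth_add_modDeath_add_potential]

/-- The modified rates are the Doob transform by u of those of the increment semigroup, so the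
weight telescopes along each path from its starting point to its end point. -/
lemma weight_mul_feynmanKac (hbirth : ∀ x, 0 < birth x) (hdeath : ∀ x, 0 ≤ death x)
    (hρ : StrictMono ρ) {t : ℝ} (ht : 0 ≤ t) (x : ℕ) :
    ENNReal.ofReal (weight ρ x) * feynmanKac (modBirth birth (weight ρ))
      (modDeath death (weight ρ)) (potential birth death (weight ρ)) t x =
    incrSum birth death (fun y => ENNReal.ofReal (weight ρ y)) x t := by
  have hu := weight_pos hρ
  rw [feynmanKac_mod_eq_pathSum hbirth hdeath hρ ht, incrSum,
    pathSum_doob hu (b := fun x => birth (x + 1)) (d := death)]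
  · simp only [mul_one]
  · intro x
    have := (hu x).ne'
    rw [modBirth]; field_simp
  · intro x
    have := (hu x).ne'
    rw [modDeath]; field_simp

lemma lipNorm_semigroup_eq_iSup_feynmanKac (hbirth : ∀ x, 0 < birth x) (hdeath0 : death 0 = 0)
    (hdeath : ∀ x, 0 ≤ death x) (hne : NonExplosive birth death) (hρ : StrictMono ρ)
    {t : ℝ} (ht : 0 ≤ t)
    (hmoment : ∀ x, FiniteMoment (weightDist ρ) (transProb birth death t x)) :
    lipNorm (weightDist ρ) (semigroup birth death t ρ) =
      ⨆ x, feynmanKac (modBirth birth (weight ρ)) (modDeath death (weight ρ))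
        (potential birth death (weight ρ)) t x := by
  have hb : ∀ x, 0 ≤ birth x := fun x => (hbirth x).le
  have hbd : ∀ x, 0 < birth x + death x := fun x => add_pos_of_pos_of_nonneg (hbirth x) (hdeath x)
  rw [lipNorm_eq_iSup hρ]
  refine iSup_congr fun x => ?_
  obtain ⟨h1, h2⟩ := semigroup_succ_sub hb hdeath hdeath0 hbd hne ht hρ.monotone
    (fun x => summable_of_lipschitz hb hdeath hbd hne hρ ht (hmoment x) (f := ρ)
      (fun x => (abs_of_pos (weight_pos hρ x)).le)) x
  change _ = incrSum birth death (fun y => ENNReal.ofReal (weight ρ y)) x t at h2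
  have hu := weight_pos hρ x
  rw [abs_of_nonneg (sub_nonneg.2 h1), ENNReal.ofReal_div_of_pos hu, h2,
    ← weight_mul_feynmanKac hbirth hdeath hρ ht x, mul_comm,
    ENNReal.mul_div_cancel_right (ENNReal.ofReal_pos.2 hu).ne' ENNReal.ofReal_ne_top]

/-! ### Curvature -/

lemma expo_antitone {a M : ℝ} (h : a ≤ M) (t : ℝ) : expo M t ≤ expo a t := by
  rcases lt_or_ge t 0 with ht | ht
  · simp [expo_of_neg _ ht]
  · rw [expo_of_nonneg _ ht, expo_of_nonneg _ ht]
    refine ENNReal.ofReal_le_ofReal (Real.exp_le_exp.2 ?_)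
    nlinarith

lemma ofReal_mul_exp_le_lconv_expo (M t : ℝ) :
    ENNReal.ofReal (t * Real.exp (-M * t)) ≤ (expo M ⋆ₗ expo M) t := by
  calc ENNReal.ofReal (t * Real.exp (-M * t))
      = ∫⁻ s, (Icc 0 t).indicator (fun _ => ENNReal.ofReal (Real.exp (-M * t))) s := by
        rw [lintegral_indicator measurableSet_Icc, setLIntegral_const, Real.volume_Icc, sub_zero,
          mul_comm, ENNReal.ofReal_mul (Real.exp_nonneg _)]
    _ ≤ (expo M ⋆ₗ expo M) t := by
        refine lintegral_mono fun s => ?_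
        by_cases hs : s ∈ Icc 0 t
        · rw [indicator_of_mem hs, expo_of_nonneg _ hs.1, expo_of_nonneg _ (by linarith [hs.2]),
            ← ENNReal.ofReal_mul (Real.exp_nonneg _), ← Real.exp_add]
          apply le_of_eq
          ring_nf
        · rw [indicator_of_notMem hs]
          exact zero_le

/-- A short-time lower bound, from the paths with at most one jump. -/
lemma le_pathSum_one {b d a : ℕ → ℝ} (hb : ∀ x, 0 ≤ b x) (hd : ∀ x, 0 ≤ d x) (x : ℕ) {M t : ℝ}
    (ht : 0 ≤ t) (h0 : a x ≤ M) (h1 : a (x + 1) ≤ M) (h2 : a (x - 1) ≤ M) :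
    ENNReal.ofReal (Real.exp (-a x * t) + (b x + d x) * (t * Real.exp (-M * t))) ≤
      pathSum b d a (fun _ => 1) x t := by
  refine le_trans ?_ (ENNReal.sum_le_tsum (Finset.range 2))
  rw [Finset.sum_range_succ, Finset.sum_range_one, ENNReal.ofReal_add (Real.exp_nonneg _)
    (mul_nonneg (add_nonneg (hb x) (hd x)) (mul_nonneg ht (Real.exp_nonneg _))),
    ENNReal.ofReal_mul (add_nonneg (hb x) (hd x))]
  refine add_le_add ?_ ?_
  · simp only [pathKernel, one_mul, expo_of_nonneg _ ht, le_refl]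
  · calc ENNReal.ofReal (b x + d x) * ENNReal.ofReal (t * Real.exp (-M * t))
        ≤ ENNReal.ofReal (b x + d x) * (expo M ⋆ₗ expo M) t := by
          gcongr; exact ofReal_mul_exp_le_lconv_expo M t
      _ = (expo M ⋆ₗ fun s => ENNReal.ofReal (b x + d x) * expo M s) t :=
          (lconv_smul_right (by fun_prop) (by fun_prop) _ t).symm
      _ ≤ pathKernel b d a (fun _ => 1) 1 x t := by
          rw [pathKernel]
          refine lintegral_mono fun s => mul_le_mul' (expo_antitone h0 s) ?_
          simp only [pathKernel, one_mul]
          rw [ENNReal.ofReal_add (hb x) (hd x), add_mul]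
          gcongr
          · exact expo_antitone h1 _
          · exact expo_antitone h2 _

/-- Both sides equal 1 at t = 0, so their right derivatives there are ordered. The rate M
contributes nothing at first order. -/
lemma le_of_forall_exp_le {κ α β M : ℝ}
    (h : ∀ t, 0 ≤ t → Real.exp (-α * t) + β * (t * Real.exp (-M * t)) ≤ Real.exp (-κ * t)) :
    κ ≤ α - β := by
  set F : ℝ → ℝ := fun t =>
    Real.exp (-κ * t) - (Real.exp (-α * t) + β * (t * Real.exp (-M * t))) with hF
  have hexp : ∀ c : ℝ, HasDerivAt (fun t : ℝ => Real.exp (-c * t)) (-c) 0 := fun c => by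
    simpa using ((hasDerivAt_id (0 : ℝ)).const_mul (-c)).exp
  have hder : HasDerivAt F (-κ - (-α + β)) 0 := by
    have h1 := ((hasDerivAt_id (0 : ℝ)).mul (hexp M)).const_mul β
    have h2 := (hexp κ).sub ((hexp α).add h1)
    simp only [id_eq, neg_mul, zero_mul, mul_zero, Real.exp_zero, mul_one, add_zero] at h2
    refine h2.congr_of_eventuallyEq (Eventually.of_forall fun t => ?_)
    simp [hF]
  have hlim := hasDerivWithinAt_iff_tendsto_slope' (s := Ioi (0 : ℝ)) (by simp) |>.1
    (hder.hasDerivWithinAt (s := Ioi 0))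
  have h0 : 0 ≤ -κ - (-α + β) := by
    refine ge_of_tendsto hlim ?_
    filter_upwards [self_mem_nhdsWithin] with t ht
    have ht' : (0 : ℝ) < t := ht
    rw [slope_def_field]
    refine div_nonneg ?_ (by linarith)
    have := h t ht'.le
    simp only [hF, mul_zero, zero_mul, Real.exp_zero]
    linarith
  linarith

end Semigroup

end

end BirthDeath

theorem mainTheorem3 (birth death ρ : ℕ → ℝ)
    (hbirth : ∀ x, 0 < birth x) (hdeath0 : death 0 = 0) (hdeath : ∀ x, 1 ≤ x → 0 < death x)
    (hne : BirthDeath.NonExplosive birth death)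
    (hρpos : ∀ x, 0 < ρ x) (hρ : StrictMono ρ)
    (hbirthInt : BirthDeath.SemigroupIntegrable
      (BirthDeath.modBirth birth (BirthDeath.weight ρ))
      (BirthDeath.modDeath death (BirthDeath.weight ρ))
      (BirthDeath.modBirth birth (BirthDeath.weight ρ)))
    (hdeathInt : BirthDeath.SemigroupIntegrable
      (BirthDeath.modBirth birth (BirthDeath.weight ρ))
      (BirthDeath.modDeath death (BirthDeath.weight ρ))
      (BirthDeath.modDeath death (BirthDeath.weight ρ)))
    (hpotInt : BirthDeath.SemigroupIntegrable
      (BirthDeath.modBirth birth (BirthDeath.weight ρ))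
      (BirthDeath.modDeath death (BirthDeath.weight ρ))
      (BirthDeath.potential birth death (BirthDeath.weight ρ)))
    (hmoment : ∀ t, 0 ≤ t → ∀ x,
      BirthDeath.FiniteMoment (BirthDeath.weightDist ρ) (BirthDeath.transProb birth death t x))
    (hV : BddBelow (Set.range (BirthDeath.potential birth death (BirthDeath.weight ρ)))) :
    (∀ t, 0 ≤ t →
      BirthDeath.lipOpNorm (BirthDeath.weightDist ρ) (BirthDeath.semigroup birth death t) =
          BirthDeath.lipNorm (BirthDeath.weightDist ρ) (BirthDeath.semigroup birth death t ρ) ∧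
      BirthDeath.lipNorm (BirthDeath.weightDist ρ) (BirthDeath.semigroup birth death t ρ) =
          ⨆ x, BirthDeath.feynmanKac
            (BirthDeath.modBirth birth (BirthDeath.weight ρ))
            (BirthDeath.modDeath death (BirthDeath.weight ρ))
            (BirthDeath.potential birth death (BirthDeath.weight ρ)) t x) ∧
    BirthDeath.IsWassersteinCurvature birth death (BirthDeath.weightDist ρ)
      (⨅ y, BirthDeath.potential birth death (BirthDeath.weight ρ) y) := by

  have hd : ∀ x, 0 ≤ death x := fun x => by
    rcases Nat.eq_zero_or_pos x with rfl | hx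
    · exact hdeath0.ge
    · exact (hdeath x hx).le
  have hb : ∀ x, 0 ≤ birth x := fun x => (hbirth x).le
  have hbd : ∀ x, 0 < birth x + death x := fun x => add_pos_of_pos_of_nonneg (hbirth x) (hd x)
  have h1 := fun t (ht : 0 ≤ t) =>
    BirthDeath.lipOpNorm_semigroup hb hd hdeath0 hbd hne hρ ht (hmoment t ht)
  have h2 := fun t (ht : 0 ≤ t) => BirthDeath.lipNorm_semigroup_eq_iSup_feynmanKac hbirth hdeath0
    hd hne hρ ht (hmoment t ht)
  have hmb : ∀ x, 0 ≤ BirthDeath.modBirth birth (BirthDeath.weight ρ) x :=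
    fun x => (BirthDeath.modBirth_pos hbirth hρ x).le
  have hmd := BirthDeath.modDeath_nonneg hd hρ
  refine ⟨fun t ht => ⟨h1 t ht, h2 t ht⟩, fun t ht => ?_, fun κ hκ => le_ciInf fun x => ?_⟩
  · rw [h1 t ht, h2 t ht]
    refine iSup_le fun x => ?_
    rw [BirthDeath.feynmanKac_mod_eq_pathSum hbirth hd hρ ht, ← BirthDeath.expo_of_nonneg _ ht]
    refine BirthDeath.pathSum_one_le_expo hmb hmd (fun x => ?_) x t
    have e1 := BirthDeath.modBirth_add_modDeath_add_potential (birth := birth) (death := death)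
      (BirthDeath.weight ρ) x
    -- The killing rate of the modified chain is V_u, bounded below by its infimum; boundedness of
    -- V_u from below makes this infimum a genuine lower bound.
    have e2 := ciInf_le hV x
    linarith
  · set a : ℕ → ℝ := fun x => birth x + death (x + 1) with ha
    have e1 := BirthDeath.modBirth_add_modDeath_add_potential (birth := birth) (death := death)
      (BirthDeath.weight ρ) x
    -- The right-hand side is V_u(x). A one-jump path from x sees only the total rates at x and its
    -- two neighbours, so M can be taken as their maximum and no global bound on the rates is
    -- required.
    have hle : κ ≤ a x - (BirthDeath.modBirth birth (BirthDeath.weight ρ) x +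
        BirthDeath.modDeath death (BirthDeath.weight ρ) x) := by
      refine BirthDeath.le_of_forall_exp_le (M := max (a x) (max (a (x + 1)) (a (x - 1))))
        fun t ht => ?_
      rw [← ENNReal.ofReal_le_ofReal_iff (Real.exp_nonneg _)]
      refine (BirthDeath.le_pathSum_one (a := a) hmb hmd x ht (le_max_left _ _)
        ((le_max_left _ _).trans (le_max_right _ _))
        ((le_max_right _ _).trans (le_max_right _ _))).trans ?_
      rw [← BirthDeath.feynmanKac_mod_eq_pathSum hbirth hd hρ ht]
      refine le_trans ?_ (hκ t ht)
      rw [h1 t ht, h2 t ht]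
      exact le_iSup (fun x => BirthDeath.feynmanKac _ _ _ t x) x
    simp only [ha] at hle
    linarith
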